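/- Let $D$ be a finite or countable set, let $\lambda,\mu:D\to(0,\infty)$, and put $\rho(z)=\lambda(z)/\mu(z)$. For every $n\in\mathbb Z_+$ let $\mathbf T_n=(\tau_n(z,z'))_{z,z'\in D}$ be the generator matrix (nonnegative off-diagonal entries, zero row sums) of an irreducible continuous-time Markov chain on $D$. Let $(N,Z)$ be the continuous-time Markov chain on $\mathbb Z_+\times D$ (jump chain with exponential holding times) whose generator matrix $\mathbf R$ has the off-diagonal entries $$R[(n,z),(n+1,z)]=\lambda(z),\qquad R[(n,z),(n-1,z)]=\mu(z)\ \ (n\ge 1),\qquad R[(n,z),(n,z')]=\rho(z)^{-n}\tau_n(z,z')\ \ (z\ne z'),$$ all other off-diagonal entries being $0$, and zero row sums. Assume that $(N,Z)$ is well defined for all times, i.e. that it is non-explosive from every starting state. Suppose that there is a function $v:D\to[0,\infty)$, not identically zero, such that $$v(z)\sum_{z'\in D}\tau_n(z,z')=\sum_{z'\in D}v(z')\,\tau_n(z',z)\qquad\text{for all } n\in\mathbb Z_+,\ z\in D,$$ that $\rho(z)<1$ for all $z\in D$, and that $$\Xi:=\sum_{z\in D}\frac{v(z)}{1-\rho(z)}<\infty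 .$$ Then $(N,Z)$ is irreducible, aperiodic (for every $h>0$, every state has period one for the skeleton chain observed at times $0,h,2h,\dots$) and positive recurrent (every state has a finite expected return time). Its transition kernel $P_t(x,\cdot)$ has the invariant probability measure $$\pi(n,z)=\frac{\rho(z)^n\,v(z)}{\Xi},\qquad (n,z)\in\mathbb Z_+\times D,$$ and, for every $x\in\mathbb Z_+\times D$, $$\|P_t(x,\cdot)-\pi\|_{TV}=\sup_{A\subseteq\mathbb Z_+\times D}|P_t(x,A)-\pi(A)|\to 0\qquad\text{as } t\to\infty .$$ -/

import Mathlib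

open MeasureTheory ProbabilityTheory Filter Topology
open scoped ENNReal NNReal

noncomputable section

/-- A (stable, conservative) generator matrix on a set `S`: the off-diagonal entries are
nonnegative and every row sums to `0`. -/
structure QMatrix (S : Type*) where
  /-- The entries of the matrix. -/
  rate : S → S → ℝ
  rate_nonneg : ∀ x y, x ≠ y → 0 ≤ rate x y
  hasSum_rate : ∀ x, HasSum (rate x) 0

namespace QMatrix

variable {S : Type*} (Q : QMatrix S)

/-- The total rate `q(x) = -Q(x, x)` of leaving the state `x`. -/
def exitRate (x : S) : ℝ := -Q.rate x x

open scoped Classical in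
/-- The off-diagonal part of a row. -/
def jumpRate (x y : S) : ℝ≥0∞ := if y = x then 0 else ENNReal.ofReal (Q.rate x y)

theorem tsum_jumpRate (x : S) : ∑' y, Q.jumpRate x y = ENNReal.ofReal (Q.exitRate x) := by
  classical
  have h := (Q.hasSum_rate x).sub (hasSum_ite_eq x (Q.rate x x))
  have hf : ∀ y, Q.jumpRate x y
      = ENNReal.ofReal (Q.rate x y - if y = x then Q.rate x x else 0) := by
    intro y
    unfold jumpRate
    split_ifs with hy
    · simp [hy]
    · simp
  rw [tsum_congr hf, ← ENNReal.ofReal_tsum_of_nonneg _ h.summable, h.tsum_eq, exitRate, zero_sub]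
  intro y
  split_ifs with hy
  · simp [hy]
  · simpa using Q.rate_nonneg x y (Ne.symm hy)

open scoped Classical in
/-- The law of the state after the first jump out of `x`: the state `y ≠ x` has probability
`Q(x, y) / q(x)`. If `x` is absorbing, the jump chain stays at `x`. -/
def jumpPMF (x : S) : PMF S :=
  if h : 0 < Q.exitRate x then
    PMF.normalize (Q.jumpRate x)
      (by rw [tsum_jumpRate]; exact (ENNReal.ofReal_pos.mpr h).ne')
      (by rw [tsum_jumpRate]; exact ENNReal.ofReal_ne_top)
  else PMF.pure x

variable [Countable S] [MeasurableSpace S] [DiscreteMeasurableSpace S]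

/-- One step of the jump chain, as a function of its past up to time `n`. -/
def jumpKernel (n : ℕ) : Kernel (Π _ : Finset.Iic n, S) S :=
  (Kernel.ofFunOfCountable fun x : S => (Q.jumpPMF x).toMeasure).comap
    (fun h : Π _ : Finset.Iic n, S => h ⟨n, Finset.mem_Iic.mpr le_rfl⟩) (by fun_prop)

instance (n : ℕ) : IsMarkovKernel (Q.jumpKernel n) := by
  have : IsMarkovKernel (Kernel.ofFunOfCountable fun x : S => (Q.jumpPMF x).toMeasure) :=
    ⟨fun x => PMF.toMeasure.isProbabilityMeasure _⟩
  unfold jumpKernel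
  infer_instance

/-- The law of the jump chain started at `x`. -/
def jumpChainLaw (x : S) : Measure (ℕ → S) :=
  Kernel.traj (X := fun _ => S) Q.jumpKernel 0 (fun _ => x)

/-- The probability measure `ℙ_x` that drives the continuous-time chain started at `x`: the jump
chain (first component) is independent of a sequence of independent exponential variables of
rate one (second component). -/
def law (x : S) : Measure ((ℕ → S) × (ℕ → ℝ)) :=
  (Q.jumpChainLaw x).prod (Measure.infinitePi fun _ : ℕ => expMeasure 1)

/-- The time spent in the `n`-th visited state: given the jump chain, it is exponential with the
exit rate of this state (infinite if that rate is zero). -/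
def holdingTime (n : ℕ) (ω : (ℕ → S) × (ℕ → ℝ)) : ℝ≥0∞ :=
  ENNReal.ofReal (ω.2 n) / ENNReal.ofReal (Q.exitRate (ω.1 n))

/-- The time of the `n`-th jump, with `jumpTime 0 = 0`. -/
def jumpTime (n : ℕ) (ω : (ℕ → S) × (ℕ → ℝ)) : ℝ≥0∞ :=
  ∑ k ∈ Finset.range n, Q.holdingTime k ω

/-- The explosion time. -/
def explosionTime (ω : (ℕ → S) × (ℕ → ℝ)) : ℝ≥0∞ := ∑' k, Q.holdingTime k ω

open scoped Classical in
/-- The (minimal) continuous-time Markov chain with generator `Q`: before the explosion time it is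
at time `t` in the state entered at the last jump up to time `t`; afterwards it is in the
cemetery `none`. -/
def process (t : ℝ≥0) (ω : (ℕ → S) × (ℕ → ℝ)) : Option S :=
  if (t : ℝ≥0∞) < Q.explosionTime ω then
    some (ω.1 (sInf {n : ℕ | (t : ℝ≥0∞) < Q.jumpTime (n + 1) ω}))
  else none

/-- The chain does not explode, from any starting state: it is defined for all times. -/
def NonExplosive : Prop := ∀ x, ∀ᵐ ω ∂Q.law x, Q.explosionTime ω = ∞

/-- The transition kernel `P_t(x, ·)`, with `P_t(x, {y}) = ℙ_x(X_t = y)`. -/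
def transition (t : ℝ≥0) : Kernel S S :=
  Kernel.ofFunOfCountable fun x =>
    Measure.sum fun y => Q.law x {ω | Q.process t ω = some y} • Measure.dirac y

/-- Irreducibility: every state is reached from every state with positive probability. -/
def IsIrreducible : Prop := ∀ x y, ∃ t : ℝ≥0, 0 < t ∧ 0 < Q.transition t x {y}

/-- Aperiodicity of a continuous-time chain: every state has period one for every skeleton chain
`X_0, X_h, X_{2h}, …` with `h > 0`. -/
def IsAperiodic : Prop :=
  ∀ x, ∀ h : ℝ≥0, 0 < h →
    ∀ d : ℕ, (∀ n : ℕ, 0 < Q.transition (n * h) x {x} → d ∣ n) → d = 1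

/-- The first return time `inf {t ≥ J₁ : X_t = x}` to `x`, where `J₁` is the first jump time. -/
def returnTime (x : S) (ω : (ℕ → S) × (ℕ → ℝ)) : ℝ≥0∞ :=
  ⨅ (t : ℝ≥0) (_ : Q.jumpTime 1 ω ≤ t) (_ : Q.process t ω = some x), (t : ℝ≥0∞)

/-- Positive recurrence: every state is absorbing or has a finite expected return time. -/
def IsPositiveRecurrent : Prop :=
  ∀ x, Q.exitRate x = 0 ∨ ∫⁻ ω, Q.returnTime x ω ∂Q.law x < ∞

end QMatrix

/-- The total variation norm `sup_A |μ(A) - ν(A)|` of the difference of two finite measures. -/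
def tvDist {S : Type*} [MeasurableSpace S] (μ ν : Measure S) : ℝ :=
  ⨆ A : {A : Set S // MeasurableSet A}, |μ.real A - ν.real A|

/-- The generator of the `M/M/1` queue with arrival rate `a` and service rate `b`. -/
def queueRate (a b : ℝ) (n m : ℕ) : ℝ :=
  if m = n + 1 then a
  else if n = m + 1 then b
  else if m = n then -(a + if n = 0 then 0 else b)
  else 0

theorem hasSum_queueRate (a b : ℝ) (n : ℕ) : HasSum (queueRate a b n) 0 := by
  have h : ∑ m ∈ Finset.range (n + 2), queueRate a b n m = 0 := by
    cases n with
    | zero => simp [queueRate, Finset.sum_range_succ]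
    | succ k =>
      rw [Finset.sum_range_succ, Finset.sum_range_succ, Finset.sum_range_succ,
        Finset.sum_eq_zero]
      · have h2 : ¬ k = k + 1 + 1 := by omega
        simp [queueRate, h2]
      · intro m hm
        have := Finset.mem_range.mp hm
        unfold queueRate
        rw [if_neg (by omega), if_neg (by omega), if_neg (by omega)]
  rw [← h]
  refine hasSum_sum_of_ne_finset_zero fun m hm => ?_
  have : ¬ m < n + 2 := fun hlt => hm (Finset.mem_range.mpr hlt)
  unfold queueRate
  rw [if_neg (by omega), if_neg (by omega), if_neg (by omega)]

section Queue

variable {D : Type*}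

/-- The traffic intensity `ρ(z) = λ(z) / μ(z)`. -/
def traffic (lam mu : D → ℝ) (z : D) : ℝ := lam z / mu z

open scoped Classical in
/-- The generator of `(N, Z)`: in the environment state `z` the queue has arrival rate `λ(z)` and
service rate `μ(z)`, and at queue length `n` the environment jumps from `z` to `z'` at rate
`ρ(z)^{-n} τ_n(z, z')`. -/
def queueEnvGenerator (lam mu : D → ℝ) (hlam : ∀ z, 0 < lam z) (hmu : ∀ z, 0 < mu z)
    (T : ℕ → QMatrix D) : QMatrix (ℕ × D) where
  rate x y :=
    (if y.2 = x.2 then queueRate (lam x.2) (mu x.2) x.1 y.1 else 0) +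
      (if y.1 = x.1 then (traffic lam mu x.2 ^ x.1)⁻¹ * (T x.1).rate x.2 y.2 else 0)
  rate_nonneg := by
    rintro ⟨n, z⟩ ⟨m, w⟩ hne
    have hl := hlam z
    have hm := hmu z
    have h1 : m ≠ n → 0 ≤ queueRate (lam z) (mu z) n m := by
      intro h
      unfold queueRate
      split_ifs <;> linarith
    have h2 : w ≠ z → 0 ≤ (traffic lam mu z ^ n)⁻¹ * (T n).rate z w := fun h =>
      mul_nonneg (inv_nonneg.mpr (pow_nonneg (div_pos hl hm).le n))
        ((T n).rate_nonneg z w h.symm)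
    by_cases hmn : m = n
    · have hw : w ≠ z := fun h => hne (by rw [hmn, h])
      simpa [hmn, hw] using h2 hw
    · by_cases hw : w = z
      · simpa [hmn, hw] using h1 hmn
      · simp [hmn, hw]
  hasSum_rate := by
    rintro ⟨n, z⟩
    have h1 : HasSum (fun y : ℕ × D =>
        if y.2 = z then queueRate (lam z) (mu z) n y.1 else 0) 0 := by
      have hi : Function.Injective fun m : ℕ => (m, z) := fun a b h => (Prod.mk.inj h).1
      refine (hi.hasSum_iff ?_).mp ?_
      · rintro ⟨m, w⟩ hw
        have : w ≠ z := fun h => hw ⟨m, by rw [h]⟩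
        simp [this]
      · simpa [Function.comp_def] using hasSum_queueRate (lam z) (mu z) n
    have h2 : HasSum (fun y : ℕ × D =>
        if y.1 = n then (traffic lam mu z ^ n)⁻¹ * (T n).rate z y.2 else 0) 0 := by
      have hi : Function.Injective fun w : D => (n, w) := fun a b h => (Prod.mk.inj h).2
      refine (hi.hasSum_iff ?_).mp ?_
      · rintro ⟨m, w⟩ hw
        have : m ≠ n := fun h => hw ⟨w, by rw [h]⟩
        simp [this]
      · simpa [Function.comp_def] using
          ((T n).hasSum_rate z).mul_left ((traffic lam mu z ^ n)⁻¹)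
    simpa using h1.add h2

/-- The normalization constant `Ξ = ∑_z v(z) / (1 - ρ(z))`. -/
def normConst (lam mu v : D → ℝ) : ℝ := ∑' z, v z / (1 - traffic lam mu z)

/-- The measure `π` with `π(n, z) = ρ(z)^n v(z) / Ξ`. -/
def stationaryMeasure [MeasurableSpace D] (lam mu v : D → ℝ) : Measure (ℕ × D) :=
  Measure.sum fun x : ℕ × D =>
    ENNReal.ofReal (traffic lam mu x.2 ^ x.1 * v x.2 / normConst lam mu v) • Measure.dirac x

end Queue

end

/-!
The chain `(N, Z)` has strictly positive exit rates, and its transition graph is connected: the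
queue length moves up and down for a fixed environment, and the environment connects the states of
level `0` because `T 0` is irreducible. The measure `π` solves the global balance equations, since
for fixed `z` the weights `ρ(z)^n` balance arrivals and services, while the factor `ρ(z)^n` cancels
against the speed `ρ(z)^{-n}` of the environment, for which `v` is balanced on each level
(`hasSum_mul_rate_queueEnvGenerator`). The rest holds for any non-explosive chain with positive
exit rates and connected graph that has a balanced probability measure `m`.

*Transition probabilities.* Let `f n x y t` be the probability that the chain started at `x` is at
`y` at time `t` after exactly `n` jumps (`nJumpProb`). The forward recursion over the last jump,
`f (n+1) x y t = ∫ s, (∑ z, f n x z s * q(z,y)) * e^{-q(y)(t-s)}`, is obtained from the construction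
of the chain by writing the law of the holding times along a fixed path as a convolution
(`expSeqLaw_holding`) and averaging over the jump chain (`lintegral_holdProb`). By induction on `n`
it yields the Chapman-Kolmogorov equation (`nJumpProb_add`), strict positivity of all transition
probabilities at positive times (`transition_pos`) and the bound `∑ x, m x * P_t(x,y) ≤ m y`
(`tsum_sum_nJumpProb_le`). Since non-explosion means that `P_t` preserves the total mass, this last
bound is an equality, so `m` is invariant (`invariant_transition`).

*Convergence.* Put `u t = P_t(·, {y})`. The second moment `∫ (u t)² dm` decreases in `t`, and between
`t` and `t + 1` it loses the `m`-average of the variances of `u t` under `P_1(x, ·)`. So these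
variances tend to `0`, and any pointwise limit of `u t` along a sequence of times is constant,
because `P_1(x, ·)` charges all states; by invariance the constant is `m {y}`
(`tendsto_semigroup_singleton`). Pointwise convergence of probability weights is convergence in
total variation (`tendsto_tvDist_of_tendsto_singleton`).

*Positive recurrence.* Up to its first return to `x`, the jump chain visits `y` at most
`w y / w x` times on average, where `w y = m(y) q(y)` is invariant for the jump chain
(`sum_tabooProb_mul_le`). Each visit lasts `1 / q(y)` on average, so the expected return time is at
most `∑ y, m(y) / w(x) = 1 / w(x)`. That the jump chain returns at all need not be known beforehand:
otherwise the holding times before the return would add up to the explosion time, which is infinite.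
-/

/-! ### The jump chain -/

namespace QMatrix

variable {S : Type*} [Countable S] [MeasurableSpace S] [DiscreteMeasurableSpace S] (Q : QMatrix S)

theorem measurable_of_dependsOn_Iic {n : ℕ} {h : (ℕ → S) → ℝ≥0∞} (hd : DependsOn h (Set.Iic n)) :
    Measurable h := by
  classical
  rcases isEmpty_or_nonempty S with hS | ⟨⟨x⟩⟩
  · exact measurable_of_empty h
  have : h = (fun w : (Π _ : Finset.Iic n, S) =>
      h fun i => if hi : i ∈ Finset.Iic n then w ⟨i, hi⟩ else x) ∘ Preorder.frestrictLe n := by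
    ext Y
    refine hd fun i hi => ?_
    have hi' : i ≤ n := hi
    simp [hi']
  rw [this]
  exact Measurable.comp .of_discrete (by fun_prop)

instance (x : S) : IsProbabilityMeasure (Q.jumpChainLaw x) := by
  unfold jumpChainLaw
  infer_instance

theorem jumpKernel_singleton (n : ℕ) (w : Π _ : Finset.Iic n, S) (y : S) :
    Q.jumpKernel n w {y} = Q.jumpPMF (w ⟨n, Finset.mem_Iic.mpr le_rfl⟩) y :=
  PMF.toMeasure_apply_singleton _ _ (measurableSet_singleton y)

/-- The Markov property of the jump chain at time `n`. -/
theorem lintegral_jumpChainLaw_succ (x : S) (n : ℕ) {h : (ℕ → S) → ℝ≥0∞}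
    (hd : DependsOn h (Set.Iic n)) (y : S) :
    ∫⁻ Y, h Y * ({y} : Set S).indicator 1 (Y (n + 1)) ∂Q.jumpChainLaw x =
      ∫⁻ Y, h Y * Q.jumpPMF (Y n) y ∂Q.jumpChainLaw x := by
  classical
  set g : (Π _ : Finset.Iic n, S) → ℝ≥0∞ :=
    fun w => h fun i => if hi : i ∈ Finset.Iic n then w ⟨i, hi⟩ else x with hg
  have hgh : ∀ Y, h Y = g (Preorder.frestrictLe n Y) := by
    intro Y
    refine hd fun i hi => ?_
    have hi' : i ≤ n := hi
    simp [hi']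
  have hgm : Measurable g := .of_discrete
  have hy : Measurable (({y} : Set S).indicator (1 : S → ℝ≥0∞)) := .of_discrete
  have key := Kernel.partialTraj_compProd_eq_map_traj (X := fun _ => S) (κ := Q.jumpKernel)
    (Nat.zero_le n) (x₀ := fun _ => x)
  have h1 : ∫⁻ Y, h Y * ({y} : Set S).indicator 1 (Y (n + 1)) ∂Q.jumpChainLaw x =
      ∫⁻ p, g p.1 * ({y} : Set S).indicator 1 p.2
        ∂((Q.jumpChainLaw x).map fun Y => (Preorder.frestrictLe n Y, Y (n + 1))) := by
    rw [lintegral_map (by fun_prop) (by fun_prop)]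
    simp_rw [hgh]
  rw [h1, jumpChainLaw, ← key, Measure.lintegral_compProd (by fun_prop),
    ← Kernel.traj_map_frestrictLe_apply, lintegral_map .of_discrete (by fun_prop)]
  refine lintegral_congr fun Y => ?_
  dsimp only
  rw [lintegral_const_mul _ hy, lintegral_indicator_one (measurableSet_singleton y),
    jumpKernel_singleton, hgh]
  rfl

theorem jumpChainLaw_zero (x : S) : ∀ᵐ Y ∂Q.jumpChainLaw x, Y 0 = x := by
  have h := Kernel.traj_map_frestrictLe_apply (X := fun _ => S) (κ := Q.jumpKernel) 0 0
    (fun _ => x)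
  rw [Kernel.partialTraj_self, Kernel.id_apply] at h
  have h2 : ∀ᵐ w ∂((Q.jumpChainLaw x).map (Preorder.frestrictLe 0)),
      w ⟨0, Finset.mem_Iic.mpr le_rfl⟩ = x := by
    rw [jumpChainLaw, h, ae_dirac_iff .of_discrete]
  exact ae_of_ae_map (by fun_prop) h2

/-- An expectation over the jump chain, split according to the state at time `n`. -/
theorem lintegral_jumpChainLaw_eq_tsum (x : S) (n : ℕ) {h : (ℕ → S) → ℝ≥0∞} (hm : Measurable h)
    (k : S → ℝ≥0∞) :
    ∫⁻ Y, h Y * k (Y n) ∂Q.jumpChainLaw x =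
      ∑' z, (∫⁻ Y, h Y * ({z} : Set S).indicator 1 (Y n) ∂Q.jumpChainLaw x) * k z := by
  have hz : ∀ z : S, Measurable (({z} : Set S).indicator (1 : S → ℝ≥0∞)) :=
    fun z => .of_discrete
  have hz' := fun z => hm.mul ((hz z).comp (measurable_pi_apply n))
  have h1 := fun z => (lintegral_mul_const (μ := Q.jumpChainLaw x) (k z) (hz' z)).symm
  refine Eq.trans ?_ (tsum_congr h1).symm
  rw [← lintegral_tsum fun z => ((hz' z).mul_const _).aemeasurable]
  refine lintegral_congr fun Y => ?_
  rw [tsum_eq_single (Y n)]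
  · simp
  · intro z hz
    simp [hz.symm]

end QMatrix

/-! ### Sums of independent exponential variables -/

/-- The tail `P(X > u) = e^{-q u}` of an exponential variable of rate `q`, extended by `0` (not by
`1`) to negative `u`, so that time convolutions can be taken over all of `ℝ`. -/
noncomputable def expTail (q u : ℝ) : ℝ≥0∞ :=
  if 0 ≤ u then ENNReal.ofReal (Real.exp (-(q * u))) else 0

theorem measurable_expTail (q : ℝ) : Measurable (expTail q) := by
  unfold expTail
  exact Measurable.ite measurableSet_Ici (by fun_prop) measurable_const

theorem measurable_expTail_uncurry : Measurable fun p : ℝ × ℝ => expTail p.1 p.2 := by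
  unfold expTail
  exact Measurable.ite (measurableSet_le measurable_const measurable_snd) (by fun_prop)
    measurable_const

theorem expTail_of_neg (q : ℝ) {u : ℝ} (hu : u < 0) : expTail q u = 0 := if_neg (not_le.mpr hu)

theorem expTail_pos (q : ℝ) {u : ℝ} (hu : 0 ≤ u) : 0 < expTail q u := by
  rw [expTail, if_pos hu]
  exact ENNReal.ofReal_pos.mpr (Real.exp_pos _)

theorem expTail_add (q : ℝ) {u w : ℝ} (hu : 0 ≤ u) (hw : 0 ≤ w) :
    expTail q (u + w) = expTail q u * expTail q w := by
  rw [expTail, expTail, expTail, if_pos hu, if_pos hw, if_pos (add_nonneg hu hw),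
    ← ENNReal.ofReal_mul (Real.exp_pos _).le, ← Real.exp_add]
  congr 2
  ring

theorem exponentialPDF_eq_expTail {q : ℝ} (hq : 0 < q) (u : ℝ) :
    exponentialPDF q u = ENNReal.ofReal q * expTail q u := by
  rw [exponentialPDF_eq, expTail]
  split_ifs
  · rw [ENNReal.ofReal_mul hq.le]
  · simp

instance : IsProbabilityMeasure (expMeasure 1) := isProbabilityMeasure_expMeasure one_pos

theorem lintegral_expMeasure_div {r : ℝ} (hr : 0 < r) (s : ℝ) {g : ℝ → ℝ≥0∞}
    (hg : Measurable g) :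
    ∫⁻ u, g (s + u / r) ∂expMeasure 1 =
      ∫⁻ v, g v * (ENNReal.ofReal r * expTail r (v - s)) := by
  have h0 : expMeasure 1 = volume.withDensity (expTail 1) := by
    have : expMeasure 1 = volume.withDensity (exponentialPDF 1) := rfl
    rw [this]
    congr 1
    ext u
    simp [exponentialPDF_eq_expTail one_pos]
  rw [h0, lintegral_withDensity_eq_lintegral_mul _ (measurable_expTail 1) (by fun_prop)]
  have hm : Measurable (expTail 1 * fun u => g (s + u / r)) :=
    (measurable_expTail 1).mul (by fun_prop)
  rw [← lintegral_add_right_eq_self (μ := volume)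
    (fun v => g v * (ENNReal.ofReal r * expTail r (v - s))) s]
  conv_lhs => rw [← Real.smul_map_volume_mul_left hr.ne']
  rw [lintegral_smul_measure, lintegral_map hm (by fun_prop), abs_of_pos hr, smul_eq_mul,
    ← lintegral_const_mul _ (f := fun a => (expTail 1 * fun u => g (s + u / r)) (r * a))
      (hm.comp (measurable_const_mul r))]
  refine lintegral_congr fun w => ?_
  have h1 : expTail 1 (r * w) = expTail r w := by
    simp [expTail, mul_nonneg_iff_of_pos_left hr]
  rw [Pi.mul_apply, h1, mul_div_cancel_left₀ _ hr.ne', add_sub_cancel_right, add_comm s]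
  ring

theorem expMeasure_Ioi {a : ℝ} (ha : 0 ≤ a) : expMeasure 1 (Set.Ioi a) = expTail 1 a := by
  have h := cdf_expMeasure_eq one_pos a
  rw [if_pos ha, cdf_eq_real] at h
  have hc : (expMeasure 1).real (Set.Iic a)ᶜ = Real.exp (-(1 * a)) := by
    rw [probReal_compl_eq_one_sub measurableSet_Iic, h]
    ring
  rw [Set.compl_Iic] at hc
  rw [expTail, if_pos ha, ← hc, ofReal_measureReal]

theorem expMeasure_ae_pos : ∀ᵐ u ∂expMeasure 1, 0 < u := by
  refine (mem_ae_iff_prob_eq_one measurableSet_Ioi).mpr ?_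
  simpa [expTail] using expMeasure_Ioi le_rfl

/-- The law of a sequence of independent exponential variables of rate one. -/
noncomputable abbrev expSeqLaw : Measure (ℕ → ℝ) := Measure.infinitePi fun _ : ℕ => expMeasure 1

theorem expSeqLaw_ae_pos : ∀ᵐ e ∂expSeqLaw, ∀ n, 0 < e n := by
  rw [ae_all_iff]
  intro n
  have h := expMeasure_ae_pos
  rw [← Measure.infinitePi_map_eval (fun _ : ℕ => expMeasure 1) n] at h
  exact ae_of_ae_map (measurable_pi_apply n).aemeasurable h

/-- The `n`-th partial sum is independent of the next variable. -/
theorem lintegral_expSeqLaw_sum (r : ℕ → ℝ) (n : ℕ) {G : ℝ × ℝ → ℝ≥0∞} (hG : Measurable G) :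
    ∫⁻ e, G (∑ k ∈ Finset.range n, e k / r k, e n) ∂expSeqLaw =
      ∫⁻ e, ∫⁻ u, G (∑ k ∈ Finset.range n, e k / r k, u) ∂expMeasure 1 ∂expSeqLaw := by
  -- only the variables before the `n`-th one are rescaled
  have hind : iIndepFun (fun (k : ℕ) (e : ℕ → ℝ) => if k < n then e k / r k else e k)
      expSeqLaw := by
    refine iIndepFun_infinitePi (X := fun k x => if k < n then x / r k else x) fun k => ?_
    split_ifs <;> fun_prop
  have h2 := hind.indepFun_finsetSum_of_notMem (s := Finset.range n) (i := n) (fun k => by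
    split_ifs <;> fun_prop) (by simp)
  have hsum : (∑ k ∈ Finset.range n, fun e : ℕ → ℝ => if k < n then e k / r k else e k) =
      fun e => ∑ k ∈ Finset.range n, e k / r k := by
    ext e
    rw [Finset.sum_apply]
    exact Finset.sum_congr rfl fun k hk => if_pos (Finset.mem_range.mp hk)
  rw [hsum] at h2
  simp only [lt_irrefl, if_false] at h2
  rw [indepFun_iff_map_prod_eq_prod_map_map (Measurable.aemeasurable (by fun_prop))
      (measurable_pi_apply n).aemeasurable,
    Measure.infinitePi_map_eval] at h2
  have h3 : ∫⁻ e, G (∑ k ∈ Finset.range n, e k / r k, e n) ∂expSeqLaw =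
      ∫⁻ p, G p ∂(expSeqLaw.map fun e => (∑ k ∈ Finset.range n, e k / r k, e n)) := by
    rw [lintegral_map hG (by fun_prop)]
  rw [h3, h2, lintegral_prod _ hG.aemeasurable, lintegral_map hG.lintegral_prod_right'
    (by fun_prop)]

/-- With holding times of rates `r 0, r 1, …`, the probability that exactly `n` of them are
completed at time `t`, as a recursion: `r n * holdProb r n` is the density of the end of the
`n`-th holding time (counted from `0`), after which the next one has to outlast `t`. -/
noncomputable def holdProb (r : ℕ → ℝ) : ℕ → ℝ → ℝ≥0∞
  | 0, t => expTail (r 0) t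
  | n + 1, t => ∫⁻ s, ENNReal.ofReal (r n) * holdProb r n s * expTail (r (n + 1)) (t - s)

theorem holdProb_eq_lintegral {r : ℕ → ℝ} (hr : ∀ n, 0 < r n) (n : ℕ) (t : ℝ) :
    holdProb r n t =
      ∫⁻ e, expTail (r n) (t - ∑ k ∈ Finset.range n, e k / r k) ∂expSeqLaw := by
  induction n generalizing t with
  | zero => simp [holdProb]
  | succ n ih =>
    have hm : ∀ k, Measurable fun p : ℝ × ℝ => expTail (r k) (p.1 - p.2) := fun k =>
      (measurable_expTail _).comp (measurable_fst.sub measurable_snd)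
    have hm' : Measurable fun v => expTail (r (n + 1)) (t - v) :=
      (measurable_expTail _).comp (measurable_const.sub measurable_id)
    have h1 := lintegral_expSeqLaw_sum r n (G := fun p => expTail (r (n + 1)) (t - (p.1 + p.2 / r n)))
      ((measurable_expTail _).comp (by fun_prop))
    simp_rw [Finset.sum_range_succ, h1]
    have h2 : ∀ e : ℕ → ℝ,
        ∫⁻ u, expTail (r (n + 1)) (t - (∑ k ∈ Finset.range n, e k / r k + u / r n)) ∂expMeasure 1 =
        ∫⁻ v, expTail (r (n + 1)) (t - v) * (ENNReal.ofReal (r n) *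
          expTail (r n) (v - ∑ k ∈ Finset.range n, e k / r k)) := fun e =>
      lintegral_expMeasure_div (hr n) _ hm'
    simp_rw [h2]
    rw [lintegral_lintegral_swap]
    · rw [holdProb]
      refine lintegral_congr fun s => ?_
      have hs : Measurable fun e : ℕ → ℝ => expTail (r n) (s - ∑ k ∈ Finset.range n, e k / r k) :=
        (measurable_expTail _).comp (by fun_prop)
      rw [lintegral_const_mul _ (hs.const_mul _), lintegral_const_mul _ hs, ih]
      ring
    · refine ((hm'.comp measurable_snd).mul (Measurable.const_mul ?_ _)).aemeasurable
      exact (measurable_expTail _).comp (by fun_prop)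

theorem expSeqLaw_holding {r : ℕ → ℝ} (hr : ∀ n, 0 < r n) (n : ℕ) (t : ℝ) :
    expSeqLaw {e | ∑ k ∈ Finset.range n, e k / r k ≤ t ∧
      t < ∑ k ∈ Finset.range (n + 1), e k / r k} = holdProb r n t := by
  have hms : MeasurableSet {p : ℝ × ℝ | p.1 ≤ t ∧ t < p.1 + p.2 / r n} :=
    (measurableSet_le measurable_fst measurable_const).inter
      (measurableSet_lt measurable_const (measurable_fst.add (measurable_snd.div_const _)))
  have h1 := lintegral_expSeqLaw_sum r n (measurable_one.indicator hms)
  have hsum : ∀ m, Measurable fun e : ℕ → ℝ => ∑ k ∈ Finset.range m, e k / r k := fun m => by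
    fun_prop
  have hme : MeasurableSet {e : ℕ → ℝ | ∑ k ∈ Finset.range n, e k / r k ≤ t ∧
      t < ∑ k ∈ Finset.range (n + 1), e k / r k} :=
    (measurableSet_le (hsum n) measurable_const).inter
      (measurableSet_lt measurable_const (hsum (n + 1)))
  rw [holdProb_eq_lintegral hr, ← lintegral_indicator_one hme]
  simp only [Finset.sum_range_succ]
  refine h1.trans (lintegral_congr fun e => ?_)
  set s := ∑ k ∈ Finset.range n, e k / r k
  rcases le_or_gt s t with hs | hs
  · have h2 : (fun u => {p : ℝ × ℝ | p.1 ≤ t ∧ t < p.1 + p.2 / r n}.indicator (1 : ℝ × ℝ → ℝ≥0∞)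
        (s, u)) = (Set.Ioi (r n * (t - s))).indicator 1 := by
      ext u
      have : t < s + u / r n ↔ r n * (t - s) < u := by
        rw [← sub_lt_iff_lt_add', lt_div_iff₀ (hr n), mul_comm]
      simp [Set.indicator_apply, hs, this]
    have h3 : 0 ≤ r n * (t - s) := mul_nonneg (hr n).le (sub_nonneg.mpr hs)
    rw [h2, lintegral_indicator_one measurableSet_Ioi, expMeasure_Ioi h3]
    simp [expTail, h3, hs]
  · rw [expTail_of_neg _ (sub_neg.mpr hs)]
    simp [hs.not_ge]

theorem holdProb_congr {r r' : ℕ → ℝ} {n : ℕ} (h : ∀ k ≤ n, r k = r' k) (t : ℝ) :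
    holdProb r n t = holdProb r' n t := by
  induction n generalizing t with
  | zero => rw [holdProb, holdProb, h 0 le_rfl]
  | succ n ih =>
    rw [holdProb, holdProb, h n n.le_succ, h (n + 1) le_rfl]
    simp_rw [ih fun k hk => h k (hk.trans n.le_succ)]

/-- An exponential variable of rate `q` is either larger than `t` or takes a value `t - s` in
`[0, t]`. -/
theorem expTail_add_lintegral {q : ℝ} (hq : 0 < q) {t : ℝ} (ht : 0 ≤ t) :
    expTail q t + ∫⁻ s in Set.Ici 0, ENNReal.ofReal q * expTail q (t - s) = 1 := by
  have h1 : ∫⁻ s in Set.Ici 0, ENNReal.ofReal q * expTail q (t - s) =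
      ∫⁻ w in Set.Iic t, exponentialPDF q w := by
    rw [← lintegral_indicator measurableSet_Ici, ← lintegral_indicator measurableSet_Iic,
      ← lintegral_sub_left_eq_self _ t]
    refine lintegral_congr fun s => ?_
    simp [Set.indicator_apply, exponentialPDF_eq_expTail hq]
  rw [h1, lintegral_exponentialPDF_eq_antiDeriv hq, if_pos ht, expTail, if_pos ht,
    ← ENNReal.ofReal_add (Real.exp_pos _).le]
  · simp
  · have : Real.exp (-(q * t)) ≤ 1 := Real.exp_le_one_iff.mpr (by nlinarith)
    linarith

/-! ### Transition probabilities with a prescribed number of jumps -/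

namespace QMatrix

section Analytic

variable {S : Type*} (Q : QMatrix S)

/-- The probability that the chain started at `x` is at `y` at time `t` after exactly `n` jumps,
defined by the recursion over the last jump (the forward equation). -/
noncomputable def nJumpProb (x : S) : ℕ → S → ℝ → ℝ≥0∞
  | 0, y, t => ({x} : Set S).indicator 1 y * expTail (Q.exitRate y) t
  | n + 1, y, t =>
    ∫⁻ s, (∑' z, nJumpProb x n z s * Q.jumpRate z y) * expTail (Q.exitRate y) (t - s)

theorem nJumpProb_of_neg (x : S) (n : ℕ) (y : S) {t : ℝ} (ht : t < 0) :
    Q.nJumpProb x n y t = 0 := by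
  induction n generalizing y t with
  | zero => simp [nJumpProb, expTail_of_neg _ ht]
  | succ n ih =>
    rw [nJumpProb, ← lintegral_zero (α := ℝ) (μ := volume)]
    refine lintegral_congr fun s => ?_
    rcases lt_or_ge s 0 with hs | hs
    · simp [ih _ hs]
    · rw [expTail_of_neg _ (by linarith), mul_zero]

theorem nJumpProb_zero_self (x : S) (t : ℝ) :
    Q.nJumpProb x 0 x t = expTail (Q.exitRate x) t := by
  simp [nJumpProb]

variable [Countable S]

theorem measurable_nJumpProb (x : S) (n : ℕ) (y : S) : Measurable (Q.nJumpProb x n y) := by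
  induction n generalizing y with
  | zero => exact (measurable_expTail _).const_mul _
  | succ n ih =>
    have h : Measurable fun p : ℝ × ℝ => (∑' z, Q.nJumpProb x n z p.2 * Q.jumpRate z y) *
        expTail (Q.exitRate y) (p.1 - p.2) :=
      (Measurable.tsum fun z => ((ih z).comp measurable_snd).mul_const _).mul
        ((measurable_expTail _).comp (measurable_fst.sub measurable_snd))
    exact h.lintegral_prod_right'

theorem measurable_tsum_nJumpProb (x : S) (n : ℕ) (y : S) :
    Measurable fun s => ∑' z, Q.nJumpProb x n z s * Q.jumpRate z y :=
  Measurable.tsum fun z => (Q.measurable_nJumpProb x n z).mul_const _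

/-- The Chapman-Kolmogorov equation, sorted by the number of jumps. -/
theorem nJumpProb_add (x : S) (n : ℕ) (y : S) {t s : ℝ} (ht : 0 ≤ t) (hs : 0 ≤ s) :
    Q.nJumpProb x n y (t + s) = ∑ p ∈ Finset.HasAntidiagonal.antidiagonal n,
      ∑' z, Q.nJumpProb x p.1 z t * Q.nJumpProb z p.2 y s := by
  have hzero : ∀ m y s, ∑' z, Q.nJumpProb x m z t * Q.nJumpProb z 0 y s =
      Q.nJumpProb x m y t * expTail (Q.exitRate y) s := by
    intro m y s
    rw [tsum_eq_single y]
    · simp [nJumpProb]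
    · intro z hz
      simp [nJumpProb, hz.symm]
  induction n generalizing y s with
  | zero =>
    simp only [Finset.Nat.antidiagonal_zero, Finset.sum_singleton, hzero]
    rw [nJumpProb, nJumpProb, expTail_add _ ht hs, mul_assoc]
  | succ n ih =>
    rw [Finset.Nat.sum_antidiagonal_succ', hzero, nJumpProb,
      ← lintegral_add_compl _ (measurableSet_Iio (a := t)), Set.compl_Iio, add_comm]
    have hA := Q.measurable_tsum_nJumpProb x n y
    have he : ∀ a, Measurable fun u => expTail (Q.exitRate y) (a - u) := fun a =>
      (measurable_expTail _).comp (measurable_const.sub measurable_id)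
    -- the part where the last jump occurs after time `t`: apply the induction hypothesis at its time
    have h1 : ∫⁻ u in Set.Ici t, (∑' z, Q.nJumpProb x n z u * Q.jumpRate z y) *
        expTail (Q.exitRate y) (t + s - u) = ∑ p ∈ Finset.HasAntidiagonal.antidiagonal n,
          ∑' v, Q.nJumpProb x p.1 v t * Q.nJumpProb v (p.2 + 1) y s := by
      have hshift : ∫⁻ u in Set.Ici t, (∑' z, Q.nJumpProb x n z u * Q.jumpRate z y) *
          expTail (Q.exitRate y) (t + s - u) =
          ∫⁻ w in Set.Ici 0, (∑' z, Q.nJumpProb x n z (t + w) * Q.jumpRate z y) *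
            expTail (Q.exitRate y) (s - w) := by
        rw [← lintegral_indicator measurableSet_Ici, ← lintegral_indicator measurableSet_Ici,
          ← lintegral_add_left_eq_self _ t]
        refine lintegral_congr fun w => ?_
        simp [Set.indicator_apply]
      have hB : ∀ v m, Measurable fun w => (∑' z, Q.nJumpProb v m z w * Q.jumpRate z y) *
          expTail (Q.exitRate y) (s - w) := fun v m =>
        (Q.measurable_tsum_nJumpProb v m y).mul (he s)
      have hexp : ∀ w ∈ Set.Ici (0 : ℝ),
          (∑' z, Q.nJumpProb x n z (t + w) * Q.jumpRate z y) * expTail (Q.exitRate y) (s - w) =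
          ∑ p ∈ Finset.HasAntidiagonal.antidiagonal n, ∑' v, Q.nJumpProb x p.1 v t *
            ((∑' z, Q.nJumpProb v p.2 z w * Q.jumpRate z y) * expTail (Q.exitRate y) (s - w)) := by
        intro w hw
        simp_rw [ih _ hw, Finset.sum_mul]
        rw [Summable.tsum_finsetSum fun _ _ => ENNReal.summable, Finset.sum_mul]
        refine Finset.sum_congr rfl fun p _ => ?_
        simp_rw [← ENNReal.tsum_mul_right]
        rw [ENNReal.tsum_comm]
        simp_rw [← ENNReal.tsum_mul_left, mul_assoc]
      rw [hshift, setLIntegral_congr_fun measurableSet_Ici hexp, lintegral_finsetSum]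
      · refine Finset.sum_congr rfl fun p _ => ?_
        rw [lintegral_tsum fun v => ((hB v p.2).const_mul _).aemeasurable]
        refine tsum_congr fun v => ?_
        rw [lintegral_const_mul _ (hB v p.2), nJumpProb, ← lintegral_indicator measurableSet_Ici]
        congr 1
        refine lintegral_congr fun w => ?_
        rcases lt_or_ge w 0 with hw | hw
        · simp [hw, Q.nJumpProb_of_neg _ _ _ hw]
        · simp [hw]
      · exact fun p _ => Measurable.tsum fun v => (hB v p.2).const_mul _
    -- the part where the last jump occurs before time `t`: the chain then rests at `y`
    have h2 : ∫⁻ u in Set.Iio t, (∑' z, Q.nJumpProb x n z u * Q.jumpRate z y) *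
        expTail (Q.exitRate y) (t + s - u) =
          Q.nJumpProb x (n + 1) y t * expTail (Q.exitRate y) s := by
      have hexp : ∀ u ∈ Set.Iic t,
          (∑' z, Q.nJumpProb x n z u * Q.jumpRate z y) * expTail (Q.exitRate y) (t + s - u) =
          (∑' z, Q.nJumpProb x n z u * Q.jumpRate z y) * expTail (Q.exitRate y) (t - u) *
            expTail (Q.exitRate y) s := by
        intro u hu
        rw [show t + s - u = (t - u) + s by ring, expTail_add _ (sub_nonneg.mpr hu) hs, mul_assoc]
      have hAe : Measurable fun u => (∑' z, Q.nJumpProb x n z u * Q.jumpRate z y) *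
          expTail (Q.exitRate y) (t - u) := hA.mul (he t)
      rw [setLIntegral_congr Iio_ae_eq_Iic, setLIntegral_congr_fun measurableSet_Iic hexp,
        lintegral_mul_const _ hAe, nJumpProb, ← lintegral_indicator measurableSet_Iic]
      congr 1
      refine lintegral_congr fun u => ?_
      rcases lt_or_ge t u with hu | hu
      · simp [hu.not_ge, expTail_of_neg _ (sub_neg.mpr hu)]
      · simp [hu]
    rw [h1, h2, add_comm]

theorem nJumpProb_succ_pos {x z y : S} {n : ℕ} (h : ∀ t, 0 < t → 0 < Q.nJumpProb x n z t)
    (hzy : 0 < Q.jumpRate z y) {t : ℝ} (ht : 0 < t) : 0 < Q.nJumpProb x (n + 1) y t := by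
  have he : Measurable fun u => expTail (Q.exitRate y) (t - u) :=
    (measurable_expTail _).comp (measurable_const.sub measurable_id)
  have hm : Measurable fun s => (∑' z, Q.nJumpProb x n z s * Q.jumpRate z y) *
      expTail (Q.exitRate y) (t - s) := (Q.measurable_tsum_nJumpProb x n y).mul he
  rw [nJumpProb, lintegral_pos_iff_support hm]
  refine lt_of_lt_of_le ?_ (measure_mono (s := Set.Ioo 0 t) fun s hs => ?_)
  · simp [ht]
  · have h1 : 0 < Q.nJumpProb x n z s * Q.jumpRate z y := ENNReal.mul_pos (h s hs.1).ne' hzy.ne'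
    have h2 : 0 < ∑' z, Q.nJumpProb x n z s * Q.jumpRate z y :=
      h1.trans_le (ENNReal.le_tsum z)
    exact (ENNReal.mul_pos h2.ne' (expTail_pos _ (sub_nonneg.mpr hs.2.le)).ne').ne'

/-- The edges of the transition graph: the direct transitions of positive rate, without loops. -/
def Edge (x y : S) : Prop := 0 < Q.jumpRate x y

theorem exists_nJumpProb_pos {x y : S} (h : Relation.ReflTransGen Q.Edge x y) :
    ∃ n, ∀ t, 0 < t → 0 < Q.nJumpProb x n y t := by
  induction h with
  | refl => exact ⟨0, fun t ht => by simpa [nJumpProb] using expTail_pos _ ht.le⟩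
  | tail _ hzy ih =>
    obtain ⟨n, hn⟩ := ih
    exact ⟨n + 1, fun t ht => Q.nJumpProb_succ_pos hn hzy ht⟩

/-- A measure that balances the flows of the generator is subinvariant for the minimal
chain: the mass that has made at most `n` jumps never exceeds it. -/
theorem tsum_sum_nJumpProb_le (hq : ∀ x, 0 < Q.exitRate x) {m : S → ℝ≥0∞}
    (hm : ∀ y, ∑' x, m x * Q.jumpRate x y = m y * ENNReal.ofReal (Q.exitRate y)) (n : ℕ) (y : S)
    {t : ℝ} (ht : 0 ≤ t) :
    ∑' x, m x * ∑ k ∈ Finset.range n, Q.nJumpProb x k y t ≤ m y := by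
  induction n generalizing y t with
  | zero => simp
  | succ n ih =>
    have he : Measurable fun s => expTail (Q.exitRate y) (t - s) :=
      (measurable_expTail _).comp (measurable_const.sub measurable_id)
    have hB : ∀ x k, Measurable fun s => (∑' z, Q.nJumpProb x k z s * Q.jumpRate z y) *
        expTail (Q.exitRate y) (t - s) := fun x k =>
      (Q.measurable_tsum_nJumpProb x k y).mul he
    have h0 : ∑' x, m x * Q.nJumpProb x 0 y t = m y * expTail (Q.exitRate y) t := by
      rw [tsum_eq_single y]
      · simp [nJumpProb]
      · intro x hx
        simp [nJumpProb, hx.symm]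
    have h1 : ∑' x, m x * ∑ k ∈ Finset.range n, Q.nJumpProb x (k + 1) y t =
        ∫⁻ s, (∑' z, (∑' x, m x * ∑ k ∈ Finset.range n, Q.nJumpProb x k z s) * Q.jumpRate z y) *
          expTail (Q.exitRate y) (t - s) := by
      have h2 : ∀ s, (∑' z, (∑' x, m x * ∑ k ∈ Finset.range n, Q.nJumpProb x k z s) *
          Q.jumpRate z y) * expTail (Q.exitRate y) (t - s) =
          ∑' x, m x * ∑ k ∈ Finset.range n, (∑' z, Q.nJumpProb x k z s * Q.jumpRate z y) *
            expTail (Q.exitRate y) (t - s) := by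
        intro s
        simp_rw [← Finset.sum_mul, ← Summable.tsum_finsetSum fun _ _ => ENNReal.summable,
          ← mul_assoc, ENNReal.tsum_mul_right, ← Finset.sum_mul, ← ENNReal.tsum_mul_left,
          ← ENNReal.tsum_mul_right]
        rw [ENNReal.tsum_comm]
        simp_rw [mul_assoc]
      simp_rw [h2]
      rw [lintegral_tsum fun x => ((Finset.measurable_fun_sum _ fun k _ => hB x k).const_mul
        _).aemeasurable]
      refine tsum_congr fun x => ?_
      rw [lintegral_const_mul _ (Finset.measurable_fun_sum _ fun k _ => hB x k),
        lintegral_finsetSum _ fun k _ => hB x k]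
      rfl
    have h3 : ∫⁻ s, (∑' z, (∑' x, m x * ∑ k ∈ Finset.range n, Q.nJumpProb x k z s) *
        Q.jumpRate z y) * expTail (Q.exitRate y) (t - s) ≤
        ∫⁻ s in Set.Ici 0, m y * (ENNReal.ofReal (Q.exitRate y) *
          expTail (Q.exitRate y) (t - s)) := by
      rw [← lintegral_indicator measurableSet_Ici]
      refine lintegral_mono fun s => ?_
      rcases lt_or_ge s 0 with hs | hs
      · simp [hs, Q.nJumpProb_of_neg _ _ _ hs]
      · rw [Set.indicator_of_mem (Set.mem_Ici.mpr hs), ← mul_assoc, ← hm y]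
        gcongr with z
        exact ih z hs
    calc ∑' x, m x * ∑ k ∈ Finset.range (n + 1), Q.nJumpProb x k y t
        = ∑' x, m x * ∑ k ∈ Finset.range n, Q.nJumpProb x (k + 1) y t +
            m y * expTail (Q.exitRate y) t := by
          simp_rw [Finset.sum_range_succ', mul_add]
          rw [ENNReal.tsum_add, h0]
      _ ≤ m y * (expTail (Q.exitRate y) t + ∫⁻ s in Set.Ici 0, ENNReal.ofReal (Q.exitRate y) *
            expTail (Q.exitRate y) (t - s)) := by
          rw [mul_add, add_comm, h1, ← lintegral_const_mul _ (he.const_mul _)]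
          gcongr
      _ = m y := by rw [expTail_add_lintegral (hq y) ht, mul_one]

end Analytic
end QMatrix

/-! ### The transition kernel of the chain -/

namespace QMatrix

section Law

variable {S : Type*} (Q : QMatrix S)

theorem jumpRate_eq_mul_jumpPMF {x : S} (hx : 0 < Q.exitRate x) (y : S) :
    Q.jumpRate x y = ENNReal.ofReal (Q.exitRate x) * Q.jumpPMF x y := by
  rw [jumpPMF, dif_pos hx, PMF.normalize_apply, tsum_jumpRate, mul_left_comm,
    ENNReal.mul_inv_cancel (ENNReal.ofReal_pos.mpr hx).ne' ENNReal.ofReal_ne_top, mul_one]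

theorem jumpTime_mono (ω : (ℕ → S) × (ℕ → ℝ)) : Monotone fun n => Q.jumpTime n ω := by
  intro a b hab
  exact Finset.sum_le_sum_of_subset (Finset.range_mono hab)

theorem jumpTime_le_explosionTime (n : ℕ) (ω : (ℕ → S) × (ℕ → ℝ)) :
    Q.jumpTime n ω ≤ Q.explosionTime ω :=
  ENNReal.sum_le_tsum _

/-- Before the explosion the process sits in its `n`-th state exactly between the `n`-th and the
`(n+1)`-st jump time. -/
theorem process_eq_some_iff (t : ℝ≥0) (ω : (ℕ → S) × (ℕ → ℝ)) (y : S) :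
    Q.process t ω = some y ↔
      ∃ n, Q.jumpTime n ω ≤ t ∧ (t : ℝ≥0∞) < Q.jumpTime (n + 1) ω ∧ ω.1 n = y := by
  have huniq : ∀ n, Q.jumpTime n ω ≤ t → (t : ℝ≥0∞) < Q.jumpTime (n + 1) ω →
      sInf {n : ℕ | (t : ℝ≥0∞) < Q.jumpTime (n + 1) ω} = n := by
    intro n h1 h2
    refine le_antisymm (Nat.sInf_le h2) (le_csInf ⟨n, h2⟩ fun m hm => ?_)
    by_contra! hlt
    exact absurd ((Q.jumpTime_mono ω (Nat.succ_le_of_lt hlt)).trans h1) (not_le.mpr hm)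
  rw [process]
  constructor
  · intro h
    split_ifs at h with ht
    set N := {n : ℕ | (t : ℝ≥0∞) < Q.jumpTime (n + 1) ω} with hN
    have hne : N.Nonempty := by
      rw [explosionTime, ENNReal.tsum_eq_iSup_nat, lt_iSup_iff] at ht
      obtain ⟨n, hn⟩ := ht
      exact ⟨n, hn.trans_le (Q.jumpTime_mono ω n.le_succ)⟩
    refine ⟨sInf N, ?_, Nat.sInf_mem hne, Option.some.inj h⟩
    rcases Nat.eq_zero_or_pos (sInf N) with h0 | h0
    · simp [h0, jumpTime]
    · have h1 := Nat.notMem_of_lt_sInf (Nat.sub_lt h0 Nat.one_pos)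
      have h2 : ¬ (t : ℝ≥0∞) < Q.jumpTime (sInf N - 1 + 1) ω := h1
      rw [Nat.sub_add_cancel h0] at h2
      exact not_lt.mp h2
  · rintro ⟨n, h1, h2, rfl⟩
    rw [if_pos (h2.trans_le (Q.jumpTime_le_explosionTime _ _)), huniq n h1 h2]

theorem jumpTime_eq_ofReal (hq : ∀ x, 0 < Q.exitRate x) {Y : ℕ → S} {e : ℕ → ℝ}
    (he : ∀ n, 0 < e n) (n : ℕ) :
    Q.jumpTime n (Y, e) = ENNReal.ofReal (∑ k ∈ Finset.range n, e k / Q.exitRate (Y k)) := by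
  rw [ENNReal.ofReal_sum_of_nonneg fun k _ => (div_pos (he k) (hq _)).le]
  exact Finset.sum_congr rfl fun k _ => (ENNReal.ofReal_div_of_pos (hq _)).symm

/-- The event that at time `t` exactly `n` jumps have occurred and the chain is at `y`. -/
def nJumpEvent (n : ℕ) (y : S) (t : ℝ≥0) : Set ((ℕ → S) × (ℕ → ℝ)) :=
  {ω | Q.jumpTime n ω ≤ t ∧ (t : ℝ≥0∞) < Q.jumpTime (n + 1) ω ∧ ω.1 n = y}

theorem pairwise_disjoint_nJumpEvent (y : S) (t : ℝ≥0) :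
    Pairwise (Function.onFun Disjoint fun n => Q.nJumpEvent n y t) := by
  have key : ∀ a b, a < b → Disjoint (Q.nJumpEvent a y t) (Q.nJumpEvent b y t) := by
    intro a b hab
    refine Set.disjoint_left.mpr fun ω ha hb => ?_
    exact absurd ((Q.jumpTime_mono ω (Nat.succ_le_of_lt hab)).trans hb.1) (not_le.mpr ha.2.1)
  intro a b hab
  rcases lt_or_gt_of_ne hab with h | h
  · exact key a b h
  · exact (key b a h).symm

theorem process_preimage_some (t : ℝ≥0) (y : S) :
    {ω | Q.process t ω = some y} = ⋃ n, Q.nJumpEvent n y t := by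
  ext ω
  rw [Set.mem_iUnion]
  exact Q.process_eq_some_iff t ω y

theorem edge_or_eq_of_jumpPMF_ne_zero {x y : S} (h : Q.jumpPMF x y ≠ 0) :
    y = x ∨ Q.Edge x y := by
  rcases lt_or_ge 0 (Q.exitRate x) with hx | hx
  · refine Or.inr (pos_iff_ne_zero.mpr fun h0 => h ?_)
    rw [jumpPMF, dif_pos hx, PMF.normalize_apply, h0, zero_mul]
  · refine Or.inl ?_
    by_contra hne
    rw [jumpPMF, dif_neg hx.not_gt, PMF.pure_apply, if_neg hne] at h
    exact h rfl

section Measurability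

variable [MeasurableSpace S] [DiscreteMeasurableSpace S]

theorem measurable_jumpTime (n : ℕ) : Measurable (Q.jumpTime n) := by
  refine Finset.measurable_fun_sum _ fun k _ => ?_
  have h : Measurable Q.exitRate := .of_discrete
  unfold holdingTime
  fun_prop

theorem measurable_holdProb_comp (n : ℕ) :
    Measurable fun p : (ℕ → S) × ℝ => holdProb (fun k => Q.exitRate (p.1 k)) n p.2 := by
  have hq : Measurable Q.exitRate := .of_discrete
  induction n with
  | zero =>
    exact measurable_expTail_uncurry.comp
      ((hq.comp ((measurable_pi_apply 0).comp measurable_fst)).prodMk measurable_snd)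
  | succ n ih =>
    have h : Measurable fun p : ((ℕ → S) × ℝ) × ℝ =>
        ENNReal.ofReal (Q.exitRate (p.1.1 n)) *
          holdProb (fun k => Q.exitRate (p.1.1 k)) n p.2 *
          expTail (Q.exitRate (p.1.1 (n + 1))) (p.1.2 - p.2) := by
      refine Measurable.mul (Measurable.mul ?_ ?_) ?_
      · exact (hq.comp ((measurable_pi_apply n).comp
          (measurable_fst.comp measurable_fst))).ennreal_ofReal
      · exact ih.comp ((measurable_fst.comp measurable_fst).prodMk measurable_snd)
      · exact measurable_expTail_uncurry.comp ((hq.comp ((measurable_pi_apply (n + 1)).comp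
          (measurable_fst.comp measurable_fst))).prodMk
          ((measurable_snd.comp measurable_fst).sub measurable_snd))
    exact h.lintegral_prod_right'

end Measurability

variable [Countable S] [MeasurableSpace S] [DiscreteMeasurableSpace S]

instance (x : S) : IsProbabilityMeasure (Q.law x) := by
  unfold law
  infer_instance

theorem measurableSet_nJumpEvent (n : ℕ) (y : S) (t : ℝ≥0) :
    MeasurableSet (Q.nJumpEvent n y t) := by
  refine (measurableSet_le (Q.measurable_jumpTime n) measurable_const).inter
    ((measurableSet_lt measurable_const (Q.measurable_jumpTime (n + 1))).inter ?_)
  have h : Measurable fun ω : (ℕ → S) × (ℕ → ℝ) => ω.1 n := by fun_prop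
  exact h (measurableSet_singleton y)

theorem measurableSet_process_eq_some (t : ℝ≥0) (y : S) :
    MeasurableSet {ω | Q.process t ω = some y} := by
  rw [process_preimage_some]
  exact MeasurableSet.iUnion fun n => Q.measurableSet_nJumpEvent n y t

/-- Averaging over the jump chain turns the convolution of holding times along its path into the
forward recursion. -/
theorem lintegral_holdProb (hq : ∀ x, 0 < Q.exitRate x) (x : S) (n : ℕ) (y : S) (t : ℝ) :
    ∫⁻ Y, holdProb (fun k => Q.exitRate (Y k)) n t * ({y} : Set S).indicator 1 (Y n)
      ∂Q.jumpChainLaw x = Q.nJumpProb x n y t := by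
  induction n generalizing y t with
  | zero =>
    have h : ∀ᵐ Y ∂Q.jumpChainLaw x, holdProb (fun k => Q.exitRate (Y k)) 0 t *
        ({y} : Set S).indicator 1 (Y 0) = Q.nJumpProb x 0 y t := by
      filter_upwards [Q.jumpChainLaw_zero x] with Y hY
      rcases eq_or_ne x y with rfl | hxy
      · simp [holdProb, nJumpProb, hY]
      · simp [nJumpProb, hY, hxy, hxy.symm]
    rw [lintegral_congr_ae h]
    simp
  | succ n ih =>
    have hqm : Measurable Q.exitRate := .of_discrete
    have hHn : Measurable fun p : (ℕ → S) × ℝ =>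
        ENNReal.ofReal (Q.exitRate (p.1 n)) * holdProb (fun k => Q.exitRate (p.1 k)) n p.2 :=
      (hqm.comp ((measurable_pi_apply n).comp measurable_fst)).ennreal_ofReal.mul
        (Q.measurable_holdProb_comp n)
    have hind : Measurable fun Y : ℕ → S => ({y} : Set S).indicator (1 : S → ℝ≥0∞) (Y (n + 1)) :=
      Measurable.comp (g := ({y} : Set S).indicator (1 : S → ℝ≥0∞)) .of_discrete
        (measurable_pi_apply (n + 1))
    have he : Measurable fun s => expTail (Q.exitRate y) (t - s) :=
      (measurable_expTail _).comp (measurable_const.sub measurable_id)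
    -- the indicator fixes the last rate to that of `y`, which frees the integral over `Y`
    have h1 : ∀ Y : ℕ → S, holdProb (fun k => Q.exitRate (Y k)) (n + 1) t *
        ({y} : Set S).indicator 1 (Y (n + 1)) =
        ∫⁻ s, ENNReal.ofReal (Q.exitRate (Y n)) * holdProb (fun k => Q.exitRate (Y k)) n s *
          ({y} : Set S).indicator 1 (Y (n + 1)) * expTail (Q.exitRate y) (t - s) := by
      intro Y
      rcases eq_or_ne (Y (n + 1)) y with hY | hY
      · simp [holdProb, hY]
      · simp [hY]
    simp_rw [h1]
    rw [lintegral_lintegral_swap, nJumpProb]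
    · refine lintegral_congr fun s => ?_
      have hd : DependsOn (fun Y : ℕ → S => ENNReal.ofReal (Q.exitRate (Y n)) *
          holdProb (fun k => Q.exitRate (Y k)) n s) (Set.Iic n) := by
        intro Y Y' h
        simp only
        rw [h n (Set.mem_Iic.mpr le_rfl),
          holdProb_congr (r' := fun k => Q.exitRate (Y' k)) fun k hk => by
            rw [h k (Set.mem_Iic.mpr hk)]]
      have hH : Measurable fun Y : ℕ → S => holdProb (fun k => Q.exitRate (Y k)) n s :=
        (Q.measurable_holdProb_comp n).comp (measurable_id.prodMk measurable_const)
      have h2 : ∀ Y : ℕ → S, ENNReal.ofReal (Q.exitRate (Y n)) *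
          holdProb (fun k => Q.exitRate (Y k)) n s * Q.jumpPMF (Y n) y =
          holdProb (fun k => Q.exitRate (Y k)) n s * Q.jumpRate (Y n) y := by
        intro Y
        rw [Q.jumpRate_eq_mul_jumpPMF (hq _)]
        ring
      have hdm : Measurable fun Y : ℕ → S => ENNReal.ofReal (Q.exitRate (Y n)) *
          holdProb (fun k => Q.exitRate (Y k)) n s * ({y} : Set S).indicator 1 (Y (n + 1)) :=
        (measurable_of_dependsOn_Iic hd).mul hind
      rw [lintegral_mul_const _ hdm,
        Q.lintegral_jumpChainLaw_succ x n hd y]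
      simp_rw [h2]
      rw [Q.lintegral_jumpChainLaw_eq_tsum x n hH fun z => Q.jumpRate z y]
      simp_rw [ih]
    · exact ((hHn.mul (hind.comp measurable_fst)).mul (he.comp measurable_snd)).aemeasurable

theorem law_nJumpEvent (hq : ∀ x, 0 < Q.exitRate x) (x : S) (n : ℕ) (y : S) (t : ℝ≥0) :
    Q.law x (Q.nJumpEvent n y t) = Q.nJumpProb x n y t := by
  rw [law, Measure.prod_apply (Q.measurableSet_nJumpEvent n y t), ← Q.lintegral_holdProb hq]
  refine lintegral_congr fun Y => ?_
  rcases eq_or_ne (Y n) y with hY | hY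
  · rw [← expSeqLaw_holding (fun k => hq (Y k)) n t]
    have h1 : ({y} : Set S).indicator (1 : S → ℝ≥0∞) (Y n) = 1 := by simp [hY]
    rw [h1, mul_one]
    refine measure_congr ?_
    filter_upwards [expSeqLaw_ae_pos] with e he
    have h0 : ∀ m, 0 ≤ ∑ k ∈ Finset.range m, e k / Q.exitRate (Y k) := fun m =>
      Finset.sum_nonneg fun k _ => (div_pos (he k) (hq _)).le
    have h2 : (Prod.mk Y ⁻¹' Q.nJumpEvent n y t) e ↔ Q.jumpTime n (Y, e) ≤ t ∧
      (t : ℝ≥0∞) < Q.jumpTime (n + 1) (Y, e) ∧ Y n = y := Iff.rfl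
    rw [Q.jumpTime_eq_ofReal hq he, Q.jumpTime_eq_ofReal hq he, ← ENNReal.ofReal_coe_nnreal,
      ENNReal.ofReal_le_ofReal_iff t.coe_nonneg,
      ENNReal.ofReal_lt_ofReal_iff_of_nonneg t.coe_nonneg] at h2
    refine propext (h2.trans ?_)
    simp only [hY, and_true]
    rfl
  · have h1 : Prod.mk Y ⁻¹' Q.nJumpEvent n y t = ∅ := by
      ext e
      simp [nJumpEvent, hY]
    simp [h1, hY]

theorem transition_apply_singleton (t : ℝ≥0) (x y : S) :
    Q.transition t x {y} = Q.law x {ω | Q.process t ω = some y} := by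
  have h : Q.transition t x = Measure.sum fun y =>
    Q.law x {ω | Q.process t ω = some y} • Measure.dirac y := rfl
  rw [h, Measure.sum_apply _ (measurableSet_singleton y), tsum_eq_single y]
  · simp
  · intro z hz
    simp [hz]

theorem transition_eq_tsum_nJumpProb (hq : ∀ x, 0 < Q.exitRate x) (t : ℝ≥0) (x y : S) :
    Q.transition t x {y} = ∑' n, Q.nJumpProb x n y t := by
  rw [transition_apply_singleton, process_preimage_some,
    measure_iUnion (Q.pairwise_disjoint_nJumpEvent y t) fun n => Q.measurableSet_nJumpEvent n y t]
  exact tsum_congr fun n => Q.law_nJumpEvent hq x n y t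

theorem isMarkovKernel_transition (hQ : Q.NonExplosive) (t : ℝ≥0) :
    IsMarkovKernel (Q.transition t) := by
  refine ⟨fun x => ⟨?_⟩⟩
  rw [← Measure.tsum_indicator_apply_singleton _ _ MeasurableSet.univ]
  simp only [Set.indicator_univ, transition_apply_singleton]
  rw [← measure_iUnion _ fun y => Q.measurableSet_process_eq_some t y]
  · refine (mem_ae_iff_prob_eq_one
      (MeasurableSet.iUnion fun y => Q.measurableSet_process_eq_some t y)).mp ?_
    filter_upwards [hQ x] with ω hω
    rw [Set.mem_iUnion]
    refine ⟨_, if_pos ?_⟩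
    rw [hω]
    exact ENNReal.coe_lt_top
  · intro y z hyz
    refine Set.disjoint_left.mpr fun ω hy hz => hyz ?_
    exact Option.some.inj (hy.symm.trans hz)

theorem transition_add_apply_singleton (hq : ∀ x, 0 < Q.exitRate x) (t s : ℝ≥0) (x y : S) :
    Q.transition (t + s) x {y} = ∑' z, Q.transition t x {z} * Q.transition s z {y} := by
  have h0 : ∀ F : ℕ × ℕ → ℝ≥0∞,
      ∑' n, ∑ p ∈ Finset.HasAntidiagonal.antidiagonal n, F p = ∑' k, ∑' l, F (k, l) := by
    intro F
    rw [← ENNReal.tsum_prod', ← Finset.HasAntidiagonal.sigmaAntidiagonalEquivProd.tsum_eq F,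
      ENNReal.tsum_sigma']
    exact tsum_congr fun n => (Finset.tsum_subtype _ F).symm
  simp_rw [Q.transition_eq_tsum_nJumpProb hq, NNReal.coe_add,
    Q.nJumpProb_add x _ y t.coe_nonneg s.coe_nonneg]
  rw [h0 fun p => ∑' z, Q.nJumpProb x p.1 z t * Q.nJumpProb z p.2 y s]
  calc ∑' k, ∑' l, ∑' z, Q.nJumpProb x k z t * Q.nJumpProb z l y s
      = ∑' k, ∑' z, ∑' l, Q.nJumpProb x k z t * Q.nJumpProb z l y s :=
        tsum_congr fun k => ENNReal.tsum_comm
    _ = ∑' z, ∑' k, ∑' l, Q.nJumpProb x k z t * Q.nJumpProb z l y s := ENNReal.tsum_comm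
    _ = _ := by simp_rw [ENNReal.tsum_mul_left, ENNReal.tsum_mul_right]

/-- The semigroup property. -/
theorem transition_add (hq : ∀ x, 0 < Q.exitRate x) (t s : ℝ≥0) :
    Q.transition (t + s) = Q.transition s ∘ₖ Q.transition t := by
  ext x : 1
  refine Measure.ext_of_singleton fun y => ?_
  rw [Q.transition_add_apply_singleton hq, Kernel.comp_apply' _ _ _ (measurableSet_singleton y),
    lintegral_countable']
  exact tsum_congr fun z => mul_comm _ _

theorem transition_pos (hq : ∀ x, 0 < Q.exitRate x) {x y : S}
    (h : Relation.ReflTransGen Q.Edge x y) {t : ℝ≥0} (ht : 0 < t) :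
    0 < Q.transition t x {y} := by
  obtain ⟨n, hn⟩ := Q.exists_nJumpProb_pos h
  rw [Q.transition_eq_tsum_nJumpProb hq]
  exact (hn t (NNReal.coe_pos.mpr ht)).trans_le (ENNReal.le_tsum n)

theorem transition_self_pos (hq : ∀ x, 0 < Q.exitRate x) (x : S) (t : ℝ≥0) :
    0 < Q.transition t x {x} := by
  rw [Q.transition_eq_tsum_nJumpProb hq]
  refine lt_of_lt_of_le ?_ (ENNReal.le_tsum 0)
  rw [nJumpProb_zero_self]
  exact expTail_pos _ t.coe_nonneg

/-- Subinvariance and conservation of mass: for a non-explosive chain, a probability measure that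
balances the flows is invariant. -/
theorem invariant_transition (hq : ∀ x, 0 < Q.exitRate x) (hQ : Q.NonExplosive) (m : Measure S)
    [IsProbabilityMeasure m]
    (hm : ∀ y, ∑' x, m {x} * Q.jumpRate x y = m {y} * ENNReal.ofReal (Q.exitRate y)) (t : ℝ≥0) :
    (Q.transition t).Invariant m := by
  have := Q.isMarkovKernel_transition hQ t
  refine Measure.eq_of_le_of_isProbabilityMeasure ?_
  refine Measure.le_iff.mpr fun s hs => ?_
  rw [← Measure.tsum_indicator_apply_singleton _ s hs, ← Measure.tsum_indicator_apply_singleton m s hs]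
  refine ENNReal.tsum_le_tsum fun y => Set.indicator_le_indicator ?_
  rw [Measure.bind_apply (measurableSet_singleton y) (Kernel.aemeasurable _), lintegral_countable']
  simp_rw [Q.transition_eq_tsum_nJumpProb hq, ← ENNReal.tsum_mul_right]
  rw [ENNReal.tsum_comm]
  refine ENNReal.tsum_le_of_sum_range_le fun n => ?_
  refine le_of_eq_of_le ?_ (Q.tsum_sum_nJumpProb_le hq hm n y t.coe_nonneg)
  rw [← Summable.tsum_finsetSum fun _ _ => ENNReal.summable]
  refine tsum_congr fun x => ?_
  rw [Finset.mul_sum]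
  exact Finset.sum_congr rfl fun k _ => mul_comm _ _

/-- The jump chain only visits states that are reachable in the transition graph. -/
theorem jumpChainLaw_ae_reachable (x : S) (n : ℕ) :
    ∀ᵐ Y ∂Q.jumpChainLaw x, Relation.ReflTransGen Q.Edge x (Y n) := by
  induction n with
  | zero =>
    filter_upwards [Q.jumpChainLaw_zero x] with Y hY
    rw [hY]
  | succ n ih =>
    have h1 : ∀ y, ∀ᵐ Y ∂Q.jumpChainLaw x, Y (n + 1) = y → Relation.ReflTransGen Q.Edge x y := by
      intro y
      by_cases hy : Relation.ReflTransGen Q.Edge x y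
      · exact Eventually.of_forall fun _ _ => hy
      · have hind : Measurable fun Y : ℕ → S =>
            ({y} : Set S).indicator (1 : S → ℝ≥0∞) (Y (n + 1)) :=
          Measurable.comp (g := ({y} : Set S).indicator (1 : S → ℝ≥0∞)) .of_discrete
            (measurable_pi_apply (n + 1))
        have h2 := Q.lintegral_jumpChainLaw_succ x n (h := fun _ => 1) (fun _ _ _ => rfl) y
        simp only [one_mul] at h2
        have h3 : ∀ᵐ Y ∂Q.jumpChainLaw x, Q.jumpPMF (Y n) y = 0 := by
          filter_upwards [ih] with Y hY
          by_contra h0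
          rcases Q.edge_or_eq_of_jumpPMF_ne_zero h0 with rfl | he
          · exact hy hY
          · exact hy (hY.tail he)
        rw [lintegral_congr_ae h3, lintegral_zero, lintegral_eq_zero_iff hind] at h2
        filter_upwards [h2] with Y hY hYy
        simp [hYy] at hY
    filter_upwards [ae_all_iff.mpr h1] with Y hY
    exact hY _ rfl

theorem reflTransGen_of_transition_pos {t : ℝ≥0} {x y : S} (h : 0 < Q.transition t x {y}) :
    Relation.ReflTransGen Q.Edge x y := by
  by_contra hxy
  rw [transition_apply_singleton] at h
  refine h.ne' ?_
  have h1 : ∀ᵐ Y ∂Q.jumpChainLaw x, ∀ n, Relation.ReflTransGen Q.Edge x (Y n) :=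
    ae_all_iff.mpr (Q.jumpChainLaw_ae_reachable x)
  have h2 : ∀ᵐ ω ∂Q.law x, ∀ n, Relation.ReflTransGen Q.Edge x (ω.1 n) :=
    Measure.quasiMeasurePreserving_fst.ae h1
  refine measure_mono_null ?_ (ae_iff.mp h2)
  intro ω hω hr
  obtain ⟨n, -, -, hn⟩ := (Q.process_eq_some_iff t ω y).mp hω
  exact hxy (hn ▸ hr n)

end Law
end QMatrix

/-! ### Convergence to equilibrium -/

section Convergence

variable {S : Type*} [MeasurableSpace S]

theorem eq_zero_of_integral_eq_zero {μ : Measure S} (hμ : ∀ x, 0 < μ {x}) {g : S → ℝ}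
    (hg : ∀ z, 0 ≤ g z) (hi : Integrable g μ) (h : ∫ z, g z ∂μ = 0) (z : S) : g z = 0 := by
  have h1 := (integral_eq_zero_iff_of_nonneg hg hi).mp h
  by_contra hz
  exact (hμ z).ne' (measure_mono_null (by simpa using hz) (ae_iff.mp h1))

variable [DiscreteMeasurableSpace S]

theorem integrable_of_mem_Icc {g : S → ℝ} {a b : ℝ} (hg : ∀ z, g z ∈ Set.Icc a b) (μ : Measure S)
    [IsFiniteMeasure μ] : Integrable g μ :=
  Integrable.of_mem_Icc a b Measurable.of_discrete.aemeasurable (Eventually.of_forall hg)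

theorem integral_integral_of_invariant {κ : Kernel S S} [IsMarkovKernel κ] {m : Measure S}
    [IsProbabilityMeasure m] (hinv : κ.Invariant m) {g : S → ℝ} {a b : ℝ}
    (hg : ∀ z, g z ∈ Set.Icc a b) : ∫ x, ∫ z, g z ∂κ x ∂m = ∫ z, g z ∂m := by
  have h : Integrable g ((κ ∘ₖ Kernel.const Unit m) ()) := by
    rw [Kernel.comp_const, hinv.def]
    exact integrable_of_mem_Icc hg m
  have h2 := Kernel.integral_comp h
  rw [Kernel.comp_const, hinv.def] at h2
  exact h2.symm

theorem integral_mem_Icc {μ : Measure S} [IsProbabilityMeasure μ] {g : S → ℝ}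
    (hg : ∀ z, g z ∈ Set.Icc (0 : ℝ) 1) : ∫ z, g z ∂μ ∈ Set.Icc (0 : ℝ) 1 := by
  refine ⟨integral_nonneg fun z => (hg z).1, ?_⟩
  simpa using integral_mono (integrable_of_mem_Icc hg μ) (integrable_const (1 : ℝ))
    fun z => (hg z).2

theorem sq_mem_Icc {a : ℝ} (h : a ∈ Set.Icc (0 : ℝ) 1) : a ^ 2 ∈ Set.Icc (0 : ℝ) 1 :=
  ⟨sq_nonneg a, pow_le_one₀ h.1 h.2⟩

/-- The second moment that is lost when a Markov kernel averages a function. -/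
theorem integral_sq_sub_integral {μ : Measure S} [IsProbabilityMeasure μ] {g : S → ℝ}
    (hg : ∀ z, g z ∈ Set.Icc (0 : ℝ) 1) :
    ∫ z, (g z - ∫ w, g w ∂μ) ^ 2 ∂μ = ∫ z, g z ^ 2 ∂μ - (∫ z, g z ∂μ) ^ 2 := by
  set c := ∫ w, g w ∂μ with hc
  have h1 : Integrable (fun z => g z ^ 2) μ := integrable_of_mem_Icc (fun z => sq_mem_Icc (hg z)) μ
  have h2 : Integrable (fun z => 2 * c * g z) μ := (integrable_of_mem_Icc hg μ).const_mul _
  have h3 : ∀ z, (g z - c) ^ 2 = g z ^ 2 - 2 * c * g z + c ^ 2 := fun z => by ring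
  simp_rw [h3]
  have h4 : Integrable (fun z => g z ^ 2 - 2 * c * g z) μ := h1.sub h2
  rw [integral_add h4 (integrable_const _), integral_sub h1 h2, integral_const_mul, ← hc,
    integral_const, probReal_univ, one_smul]
  ring

variable [Countable S] {κ : ℝ≥0 → Kernel S S} [∀ t, IsMarkovKernel (κ t)]

theorem real_singleton_add (hadd : ∀ t s, κ (t + s) = κ s ∘ₖ κ t) (t s : ℝ≥0) (x y : S) :
    (κ (t + s) x).real {y} = ∫ z, (κ s z).real {y} ∂κ t x := by
  rw [measureReal_def, hadd, Kernel.comp_apply' _ _ _ (measurableSet_singleton y)]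
  exact (integral_toReal Measurable.of_discrete.aemeasurable
    (Eventually.of_forall fun z => measure_lt_top _ _)).symm

/-- A Markov semigroup whose kernel at time one charges all states and that has an invariant
probability measure converges pointwise to this measure. The second moment of
`u t = P_t(·, {y})` under the invariant measure decreases in `t`, so its limit is the same at
`t` and `t + 1`. Hence along any sequence of times on which `u t` converges, `P_1` loses none of the
second moment of the limit, so that the limit is constant; its mean is the mean of `u t`. -/
theorem tendsto_semigroup_singleton (hadd : ∀ t s, κ (t + s) = κ s ∘ₖ κ t) {m : Measure S}
    [IsProbabilityMeasure m] (hinv : ∀ t, (κ t).Invariant m) (hm : ∀ x, 0 < m {x})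
    (hpos : ∀ x y, 0 < κ 1 x {y}) (x y : S) :
    Tendsto (fun t => (κ t x).real {y}) atTop (𝓝 (m.real {y})) := by
  set u : ℝ≥0 → S → ℝ := fun t z => (κ t z).real {y} with hu
  have hu01 : ∀ t z, u t z ∈ Set.Icc (0 : ℝ) 1 := fun t z => ⟨measureReal_nonneg, measureReal_le_one⟩
  have hstep : ∀ t s z, u (t + s) z = ∫ w, u s w ∂κ t z := fun t s z =>
    real_singleton_add hadd t s z y
  have hmean : ∀ t, ∫ z, u t z ∂m = m.real {y} := by
    intro t
    have h : ∫ z, u t z ∂m = (∫⁻ z, κ t z {y} ∂m).toReal :=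
      integral_toReal Measurable.of_discrete.aemeasurable
        (Eventually.of_forall fun z => measure_lt_top _ _)
    rw [h, ← Measure.bind_apply (measurableSet_singleton y) (Kernel.aemeasurable _), (hinv t).def]
    rfl
  set V : ℝ≥0 → ℝ := fun t => ∫ z, u t z ^ 2 ∂m with hV
  -- averaging by the kernel loses the mean of the variances
  have hloss : ∀ (t : ℝ≥0) (g : S → ℝ), (∀ z, g z ∈ Set.Icc (0 : ℝ) 1) →
      ∫ x, ∫ z, (g z - ∫ w, g w ∂κ t x) ^ 2 ∂κ t x ∂m =
        ∫ z, g z ^ 2 ∂m - ∫ x, (∫ w, g w ∂κ t x) ^ 2 ∂m := by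
    intro t g hg
    have hg2 : ∀ z, g z ^ 2 ∈ Set.Icc (0 : ℝ) 1 := fun z => sq_mem_Icc (hg z)
    simp_rw [integral_sq_sub_integral hg]
    rw [integral_sub (integrable_of_mem_Icc (fun x => integral_mem_Icc hg2) m)
      (integrable_of_mem_Icc (fun x => sq_mem_Icc (integral_mem_Icc hg)) m),
      integral_integral_of_invariant (hinv t) hg2]
  have hanti : Antitone V := by
    intro t t' htt'
    obtain ⟨s, rfl⟩ := exists_add_of_le htt'
    have h := hloss s (u t) (hu01 t)
    simp_rw [← hstep, add_comm s t] at h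
    have h0 : 0 ≤ ∫ x, ∫ z, (u t z - u (t + s) x) ^ 2 ∂κ s x ∂m :=
      integral_nonneg fun x => integral_nonneg fun z => sq_nonneg _
    rw [h] at h0
    exact sub_nonneg.mp h0
  have hVlim : Tendsto V atTop (𝓝 (⨅ t, V t)) :=
    tendsto_atTop_ciInf hanti ⟨0, by
      rintro _ ⟨t, rfl⟩
      exact integral_nonneg fun z => sq_nonneg _⟩
  have hDCT : ∀ (μ : Measure S) [IsProbabilityMeasure μ] (f : ℕ → S → ℝ) (g : S → ℝ),
      (∀ n z, f n z ∈ Set.Icc (0 : ℝ) 1) → (∀ z, Tendsto (fun n => f n z) atTop (𝓝 (g z))) →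
      Tendsto (fun n => ∫ z, f n z ∂μ) atTop (𝓝 (∫ z, g z ∂μ)) := by
    intro μ _ f g hf hfg
    refine tendsto_integral_of_dominated_convergence (fun _ => 1)
      (fun n => Measurable.of_discrete.aestronglyMeasurable) (integrable_const 1)
      (fun n => Eventually.of_forall fun z => ?_) (Eventually.of_forall hfg)
    rw [Real.norm_of_nonneg (hf n z).1]
    exact (hf n z).2
  -- by compactness of `[0, 1]^S`, a pointwise limit `g` along a subsequence of any sequence of times
  refine tendsto_of_subseq_tendsto fun ns hns => ?_
  obtain ⟨g, hg, φ, hφ, hlim⟩ := (isCompact_univ_pi fun _ : S =>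
    isCompact_Icc (a := (0 : ℝ)) (b := 1)).tendsto_subseq (x := fun n => u (ns n))
      fun n z _ => hu01 (ns n) z
  have hg01 : ∀ z, g z ∈ Set.Icc (0 : ℝ) 1 := fun z => hg z (Set.mem_univ z)
  rw [tendsto_pi_nhds] at hlim
  have htime : Tendsto (fun n => ns (φ n)) atTop atTop := hns.comp hφ.tendsto_atTop
  have hV1 : ∫ z, g z ^ 2 ∂m = ⨅ t, V t :=
    tendsto_nhds_unique (hDCT m (fun n z => u (ns (φ n)) z ^ 2) _
      (fun n z => sq_mem_Icc (hu01 _ z)) fun z => (hlim z).pow 2) (hVlim.comp htime)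
  -- the averaged limit has the same second moment, as `u (1 + t) = P_1 (u t)`
  have hV2 : ∫ x, (∫ w, g w ∂κ 1 x) ^ 2 ∂m = ⨅ t, V t := by
    refine tendsto_nhds_unique (hDCT m (fun n z => u (1 + ns (φ n)) z ^ 2) _
      (fun n z => sq_mem_Icc (hu01 _ z)) fun z => ?_)
      (hVlim.comp (tendsto_atTop_mono (fun n => le_add_self) htime))
    simp_rw [hstep]
    exact (hDCT (κ 1 z) (fun n => u (ns (φ n))) g (fun n => hu01 _) hlim).pow 2
  have hzero := hloss 1 g hg01
  rw [hV1, hV2, sub_self] at hzero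
  have hsq : ∀ x z, (g z - ∫ w, g w ∂κ 1 x) ^ 2 ∈ Set.Icc (0 : ℝ) 1 := by
    intro x z
    have h1 := hg01 z
    have h2 := integral_mem_Icc (μ := κ 1 x) hg01
    exact ⟨sq_nonneg _, by rw [sq_le_one_iff_abs_le_one, abs_le]; constructor <;>
      linarith [h1.1, h1.2, h2.1, h2.2]⟩
  have hvar := eq_zero_of_integral_eq_zero hm (fun x => integral_nonneg fun z => sq_nonneg _)
    (integrable_of_mem_Icc (fun x => integral_mem_Icc (hsq x)) m) hzero x
  have hconst : ∀ z, g z = ∫ w, g w ∂κ 1 x := by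
    intro z
    have h := eq_zero_of_integral_eq_zero (hpos x) (fun z => sq_nonneg (g z - ∫ w, g w ∂κ 1 x))
      (integrable_of_mem_Icc (hsq x) _) hvar z
    exact sub_eq_zero.mp (pow_eq_zero_iff two_ne_zero |>.mp h)
  have hgm : ∫ z, g z ∂m = m.real {y} := by
    refine tendsto_nhds_unique (hDCT m (fun n => u (ns (φ n))) g (fun n => hu01 _) hlim) ?_
    simp_rw [hmean]
    exact tendsto_const_nhds
  have hgx : g x = m.real {y} := by
    rw [← hgm]
    calc g x = ∫ w, g w ∂κ 1 x := hconst x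
      _ = ∫ z, (∫ w, g w ∂κ 1 x) ∂m := by simp
      _ = ∫ z, g z ∂m := integral_congr_ae (Eventually.of_forall fun z => (hconst z).symm)
  exact ⟨φ, hgx ▸ hlim x⟩

theorem tsum_measure_singleton (m : Measure S) [IsProbabilityMeasure m] : ∑' y, m {y} = 1 := by
  rw [← measure_univ (μ := m), ← Measure.tsum_indicator_apply_singleton _ _ MeasurableSet.univ]
  simp

/-- Scheffé's lemma on a countable space: pointwise convergence of the weights of probability measures
implies convergence in total variation. -/
theorem tendsto_tvDist_of_tendsto_singleton {ι : Type*} {l : Filter ι} [l.IsCountablyGenerated]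
    {μ : ι → Measure S} [∀ i, IsProbabilityMeasure (μ i)] {m : Measure S} [IsProbabilityMeasure m]
    (h : ∀ y, Tendsto (fun i => (μ i).real {y}) l (𝓝 (m.real {y}))) :
    Tendsto (fun i => tvDist (μ i) m) l (𝓝 0) := by
  -- the positive part of `m - μ i` is dominated by `m`
  set δ : ι → ℝ≥0∞ := fun i => ∑' y, (m {y} - μ i {y}) with hδ
  have hmass := tsum_measure_singleton m
  have hδle : ∀ i, δ i ≤ 1 := fun i =>
    hmass ▸ ENNReal.tsum_le_tsum fun y => tsub_le_self
  have hδlim : Tendsto δ l (𝓝 0) := by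
    have h1 : Tendsto (fun i => ∫⁻ y, (m {y} - μ i {y}) ∂Measure.count) l
        (𝓝 (∫⁻ _ : S, 0 ∂Measure.count)) := by
      refine tendsto_lintegral_filter_of_dominated_convergence (fun y => m {y})
        (Eventually.of_forall fun i => .of_discrete)
        (Eventually.of_forall fun i => Eventually.of_forall fun y => tsub_le_self) ?_
        (Eventually.of_forall fun y => ?_)
      · rw [lintegral_count, hmass]
        exact ENNReal.one_ne_top
      · have h2 : Tendsto (fun i => μ i {y}) l (𝓝 (m {y})) :=
          (ENNReal.tendsto_toReal_iff (fun i => measure_ne_top _ _) (measure_ne_top _ _)).mp (h y)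
        simpa using ENNReal.Tendsto.sub (tendsto_const_nhds (x := m {y})) h2
          (Or.inl (measure_ne_top _ _))
    simpa [lintegral_count] using h1
  have hle : ∀ i (A : Set S), m.real A ≤ (μ i).real A + (δ i).toReal := by
    intro i A
    have hA : MeasurableSet A := .of_discrete
    have h1 : m A ≤ μ i A + δ i := by
      rw [← Measure.tsum_indicator_apply_singleton _ A hA,
        ← Measure.tsum_indicator_apply_singleton (μ i) A hA, ← ENNReal.tsum_add]
      refine ENNReal.tsum_le_tsum fun y => ?_
      by_cases hy : y ∈ A
      · simp only [Set.indicator_of_mem hy]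
        exact le_add_tsub
      · simp [hy]
    have hδtop : δ i ≠ ∞ := ((hδle i).trans_lt ENNReal.one_lt_top).ne
    rw [measureReal_def, measureReal_def, ← ENNReal.toReal_add (measure_ne_top _ _) hδtop]
    exact ENNReal.toReal_mono (ENNReal.add_ne_top.mpr ⟨measure_ne_top _ _, hδtop⟩) h1
  have hbound : ∀ i, tvDist (μ i) m ≤ (δ i).toReal := by
    intro i
    refine Real.iSup_le (fun A => ?_) ENNReal.toReal_nonneg
    have h1 := hle i A
    have h2 := hle i (A : Set S)ᶜ
    rw [probReal_compl_eq_one_sub A.2, probReal_compl_eq_one_sub A.2] at h2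
    rw [abs_le]
    constructor <;> linarith
  refine squeeze_zero (fun i => Real.iSup_nonneg fun A => abs_nonneg _) hbound ?_
  exact (ENNReal.tendsto_toReal ENNReal.zero_ne_top).comp hδlim

end Convergence

/-! ### Positive recurrence -/

theorem lintegral_expMeasure_ofReal_le : ∫⁻ u, ENNReal.ofReal u ∂expMeasure 1 ≤ 1 := by
  rw [lintegral_eq_lintegral_meas_lt (f := fun u : ℝ => u) _
    (expMeasure_ae_pos.mono fun u hu => hu.le) aemeasurable_id]
  calc ∫⁻ t in Set.Ioi 0, expMeasure 1 {a | t < a}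
      = ∫⁻ t in Set.Ioi 0, exponentialPDF 1 t := by
        refine setLIntegral_congr_fun measurableSet_Ioi fun t ht => ?_
        rw [exponentialPDF_eq_expTail one_pos, ENNReal.ofReal_one, one_mul]
        exact expMeasure_Ioi (le_of_lt ht)
    _ ≤ ∫⁻ t, exponentialPDF 1 t := setLIntegral_le_lintegral _ _
    _ = 1 := lintegral_exponentialPDF_eq_one one_pos

namespace QMatrix

section Recurrence

variable {S : Type*}

open scoped Classical in
/-- The indicator of the paths of the jump chain that do not visit `x` at the times `1, …, n`. -/
noncomputable def avoid (x : S) (n : ℕ) (Y : ℕ → S) : ℝ≥0∞ :=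
  if ∀ k, 1 ≤ k → k ≤ n → Y k ≠ x then 1 else 0

theorem avoid_of_forall {x : S} {n : ℕ} {Y : ℕ → S} (h : ∀ k, 1 ≤ k → k ≤ n → Y k ≠ x) :
    avoid x n Y = 1 := if_pos h

theorem avoid_zero (x : S) (Y : ℕ → S) : avoid x 0 Y = 1 :=
  avoid_of_forall fun k h1 h2 => by omega

theorem avoid_succ_of_eq {x : S} {n : ℕ} {Y : ℕ → S} (h : Y (n + 1) = x) :
    avoid x (n + 1) Y = 0 :=
  if_neg fun h' => h' (n + 1) (by omega) le_rfl h

theorem avoid_succ_of_ne {x : S} {n : ℕ} {Y : ℕ → S} (h : Y (n + 1) ≠ x) :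
    avoid x (n + 1) Y = avoid x n Y := by
  unfold avoid
  congr 1
  refine propext ⟨fun h' k h1 h2 => h' k h1 (by omega), fun h' k h1 h2 => ?_⟩
  rcases Nat.lt_or_ge n k with hk | hk
  · rwa [show k = n + 1 by omega]
  · exact h' k h1 hk

theorem dependsOn_avoid (x : S) (n : ℕ) : DependsOn (avoid x n) (Set.Iic n) := by
  intro Y Y' h
  have hY : ∀ k ≤ n, Y k = Y' k := fun k hk => h k hk
  unfold avoid
  congr 1
  exact propext (forall_congr' fun k => imp_congr_right fun _ => forall_congr' fun h2 => by
    rw [hY k h2])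

/-- The holding times before the first return bound the return time. If there is no return, they
add up to the explosion time. -/
theorem returnTime_le (Q : QMatrix S) (hq : ∀ x, 0 < Q.exitRate x) {x : S} {Y : ℕ → S} {e : ℕ → ℝ}
    (he : ∀ n, 0 < e n) (hex : Q.explosionTime (Y, e) = ∞) :
    Q.returnTime x (Y, e) ≤ ∑' k, avoid x k Y * Q.holdingTime k (Y, e) := by
  by_cases hτ : ∃ n, 1 ≤ n ∧ Y n = x
  · classical
    set τ := Nat.find hτ with hτdef
    obtain ⟨h1, hx⟩ := Nat.find_spec hτ
    have hav : ∀ k < τ, avoid x k Y = 1 := fun k hk => avoid_of_forall fun j hj1 hj2 hj =>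
      Nat.find_min hτ (lt_of_le_of_lt hj2 hk) ⟨hj1, hj⟩
    have hT := Q.jumpTime_eq_ofReal hq (Y := Y) he τ
    have hTtop : Q.jumpTime τ (Y, e) ≠ ∞ := hT ▸ ENNReal.ofReal_ne_top
    have hcoe : ((Q.jumpTime τ (Y, e)).toNNReal : ℝ≥0∞) = Q.jumpTime τ (Y, e) :=
      ENNReal.coe_toNNReal hTtop
    have hhold : Q.holdingTime τ (Y, e) ≠ 0 :=
      (ENNReal.div_pos (ENNReal.ofReal_pos.mpr (he τ)).ne' ENNReal.ofReal_ne_top).ne'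
    have hproc : Q.process (Q.jumpTime τ (Y, e)).toNNReal (Y, e) = some x := by
      refine (Q.process_eq_some_iff _ _ _).mpr ⟨τ, hcoe.ge, ?_, hx⟩
      have hs : Q.jumpTime (τ + 1) (Y, e) = Q.jumpTime τ (Y, e) + Q.holdingTime τ (Y, e) :=
        Finset.sum_range_succ _ _
      rw [hcoe, hs]
      exact ENNReal.lt_add_right hTtop hhold
    calc Q.returnTime x (Y, e) ≤ ((Q.jumpTime τ (Y, e)).toNNReal : ℝ≥0∞) :=
          iInf_le_of_le _ (iInf_le_of_le ((Q.jumpTime_mono (Y, e) h1).trans hcoe.ge)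
            (iInf_le_of_le hproc le_rfl))
      _ = ∑ k ∈ Finset.range τ, avoid x k Y * Q.holdingTime k (Y, e) := by
          rw [hcoe]
          refine Finset.sum_congr rfl fun k hk => ?_
          rw [hav k (Finset.mem_range.mp hk), one_mul]
      _ ≤ _ := ENNReal.sum_le_tsum _
  · push Not at hτ
    have h : ∀ k, avoid x k Y * Q.holdingTime k (Y, e) = Q.holdingTime k (Y, e) := fun k => by
      rw [avoid_of_forall fun j hj _ => hτ j hj, one_mul]
    rw [tsum_congr h]
    exact le_top.trans hex.ge

variable [Countable S] [MeasurableSpace S] [DiscreteMeasurableSpace S] (Q : QMatrix S)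

/-- The probability that the jump chain started at `x` is at `y` at time `n` and has not returned
to `x` up to time `n`. -/
noncomputable def tabooProb (x : S) (n : ℕ) (y : S) : ℝ≥0∞ :=
  ∫⁻ Y, avoid x n Y * ({y} : Set S).indicator 1 (Y n) ∂Q.jumpChainLaw x

theorem tabooProb_zero_le (x y : S) : Q.tabooProb x 0 y ≤ ({x} : Set S).indicator 1 y := by
  have h : ∀ᵐ Y ∂Q.jumpChainLaw x, avoid x 0 Y * ({y} : Set S).indicator 1 (Y 0) =
      ({x} : Set S).indicator 1 y := by
    filter_upwards [Q.jumpChainLaw_zero x] with Y hY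
    rcases eq_or_ne x y with rfl | hxy
    · simp [avoid_zero, hY]
    · simp [hY, hxy, hxy.symm]
  rw [tabooProb, lintegral_congr_ae h]
  simp

theorem tabooProb_succ_self (x : S) (n : ℕ) : Q.tabooProb x (n + 1) x = 0 := by
  rw [tabooProb, ← lintegral_zero (μ := Q.jumpChainLaw x)]
  refine lintegral_congr fun Y => ?_
  by_cases hY : Y (n + 1) = x
  · rw [avoid_succ_of_eq hY, zero_mul]
  · simp [hY]

theorem tabooProb_succ_of_ne {x y : S} (hxy : y ≠ x) (n : ℕ) :
    Q.tabooProb x (n + 1) y = ∑' z, Q.tabooProb x n z * Q.jumpPMF z y := by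
  have h : ∀ Y : ℕ → S, avoid x (n + 1) Y * ({y} : Set S).indicator 1 (Y (n + 1)) =
      avoid x n Y * ({y} : Set S).indicator 1 (Y (n + 1)) := by
    intro Y
    by_cases hY : Y (n + 1) = y
    · rw [avoid_succ_of_ne (hY ▸ hxy)]
    · simp [hY]
  rw [tabooProb]
  simp_rw [h]
  rw [Q.lintegral_jumpChainLaw_succ x n (dependsOn_avoid x n) y]
  exact Q.lintegral_jumpChainLaw_eq_tsum x n (measurable_of_dependsOn_Iic (dependsOn_avoid x n))
    fun z => Q.jumpPMF z y

/-- Among the measures that are invariant for the jump chain and have given mass at `x`, the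
expected numbers of visits during an excursion from `x` are minimal. -/
theorem sum_tabooProb_mul_le {w : S → ℝ≥0∞} (hw : ∀ y, ∑' z, w z * Q.jumpPMF z y = w y) (x : S)
    (n : ℕ) (y : S) : (∑ k ∈ Finset.range n, Q.tabooProb x k y) * w x ≤ w y := by
  induction n generalizing y with
  | zero => simp
  | succ n ih =>
    rw [Finset.sum_range_succ']
    rcases eq_or_ne y x with rfl | hxy
    · have h1 := Q.tabooProb_zero_le y y
      simp only [Q.tabooProb_succ_self, Finset.sum_const_zero, zero_add]
      calc Q.tabooProb y 0 y * w y ≤ 1 * w y := by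
            gcongr
            simpa using h1
        _ = w y := one_mul _
    · have h0 : Q.tabooProb x 0 y = 0 := by
        simpa [hxy] using Q.tabooProb_zero_le x y
      rw [h0, add_zero]
      simp_rw [Q.tabooProb_succ_of_ne hxy]
      rw [← Summable.tsum_finsetSum fun _ _ => ENNReal.summable, ← ENNReal.tsum_mul_right]
      calc ∑' z, (∑ k ∈ Finset.range n, Q.tabooProb x k z * Q.jumpPMF z y) * w x
          = ∑' z, (∑ k ∈ Finset.range n, Q.tabooProb x k z) * w x * Q.jumpPMF z y := by
            refine tsum_congr fun z => ?_
            rw [← Finset.sum_mul]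
            ring
        _ ≤ ∑' z, w z * Q.jumpPMF z y := by
            gcongr with z
            exact ih z
        _ = w y := hw y

theorem lintegral_avoid_mul_holdingTime_le (x : S) (k : ℕ) :
    ∫⁻ ω, avoid x k ω.1 * Q.holdingTime k ω ∂Q.law x ≤
      ∑' y, Q.tabooProb x k y * (ENNReal.ofReal (Q.exitRate y))⁻¹ := by
  have hq : Measurable fun y => (ENNReal.ofReal (Q.exitRate y))⁻¹ := .of_discrete
  have ha : Measurable (avoid x k) := measurable_of_dependsOn_Iic (dependsOn_avoid x k)
  have hmean : ∫⁻ e : ℕ → ℝ, ENNReal.ofReal (e k) ∂expSeqLaw ≤ 1 := by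
    have h := lintegral_expMeasure_ofReal_le
    rwa [← Measure.infinitePi_map_eval (fun _ : ℕ => expMeasure 1) k,
      lintegral_map ENNReal.measurable_ofReal (measurable_pi_apply k)] at h
  have hek : Measurable fun e : ℕ → ℝ => ENNReal.ofReal (e k) := by fun_prop
  have hmeas : Measurable fun ω : (ℕ → S) × (ℕ → ℝ) => avoid x k ω.1 *
      (ENNReal.ofReal (ω.2 k) * (ENNReal.ofReal (Q.exitRate (ω.1 k)))⁻¹) :=
    (ha.comp measurable_fst).mul ((hek.comp measurable_snd).mul
      (hq.comp ((measurable_pi_apply k).comp measurable_fst)))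
  simp only [holdingTime, div_eq_mul_inv]
  rw [law, lintegral_prod _ hmeas.aemeasurable]
  calc ∫⁻ Y, ∫⁻ e, avoid x k Y * (ENNReal.ofReal (e k) * (ENNReal.ofReal (Q.exitRate (Y k)))⁻¹)
        ∂expSeqLaw ∂Q.jumpChainLaw x
      ≤ ∫⁻ Y, avoid x k Y * (ENNReal.ofReal (Q.exitRate (Y k)))⁻¹ ∂Q.jumpChainLaw x := by
        refine lintegral_mono fun Y => ?_
        rw [lintegral_const_mul _ (hek.mul_const _), lintegral_mul_const _ hek]
        gcongr
        exact mul_le_of_le_one_left zero_le hmean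
    _ = _ := Q.lintegral_jumpChainLaw_eq_tsum x k ha fun y => (ENNReal.ofReal (Q.exitRate y))⁻¹

/-- The expected return time to `x` is at most `1 / (m(x) q(x))`, if the probability measure
`m` balances the flows. -/
theorem isPositiveRecurrent_of_balance (hq : ∀ x, 0 < Q.exitRate x) (hQ : Q.NonExplosive)
    (m : Measure S) [IsProbabilityMeasure m]
    (hm : ∀ y, ∑' x, m {x} * Q.jumpRate x y = m {y} * ENNReal.ofReal (Q.exitRate y))
    (hpos : ∀ x, 0 < m {x}) : Q.IsPositiveRecurrent := by
  intro x
  right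
  set w : S → ℝ≥0∞ := fun y => m {y} * ENNReal.ofReal (Q.exitRate y) with hwdef
  have hw : ∀ y, ∑' z, w z * Q.jumpPMF z y = w y := by
    intro y
    refine Eq.trans (tsum_congr fun z => ?_) (hm y)
    rw [Q.jumpRate_eq_mul_jumpPMF (hq z), mul_assoc]
  have hq0 : ∀ y, ENNReal.ofReal (Q.exitRate y) ≠ 0 := fun y => (ENNReal.ofReal_pos.mpr (hq y)).ne'
  have hwx0 : w x ≠ 0 := mul_ne_zero (hpos x).ne' (hq0 x)
  have hwxt : w x ≠ ∞ := ENNReal.mul_ne_top (measure_ne_top _ _) ENNReal.ofReal_ne_top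
  have hvisits : ∀ y, (∑' k, Q.tabooProb x k y) ≤ w y / w x := by
    intro y
    refine ENNReal.tsum_le_of_sum_range_le fun n => ?_
    rw [ENNReal.le_div_iff_mul_le (Or.inl hwx0) (Or.inl hwxt)]
    exact Q.sum_tabooProb_mul_le hw x n y
  have hmass := tsum_measure_singleton m
  have hmeas : ∀ k, Measurable fun ω : (ℕ → S) × (ℕ → ℝ) => avoid x k ω.1 * Q.holdingTime k ω := by
    intro k
    have h : Measurable Q.exitRate := .of_discrete
    refine ((measurable_of_dependsOn_Iic (dependsOn_avoid x k)).comp measurable_fst).mul ?_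
    unfold holdingTime
    fun_prop
  have hae : ∀ᵐ ω ∂Q.law x, ∀ n, 0 < ω.2 n := Measure.quasiMeasurePreserving_snd.ae expSeqLaw_ae_pos
  calc ∫⁻ ω, Q.returnTime x ω ∂Q.law x
      ≤ ∫⁻ ω, ∑' k, avoid x k ω.1 * Q.holdingTime k ω ∂Q.law x := by
        refine lintegral_mono_ae ?_
        filter_upwards [hQ x, hae] with ω h1 h2
        exact Q.returnTime_le hq h2 h1
    _ = ∑' k, ∫⁻ ω, avoid x k ω.1 * Q.holdingTime k ω ∂Q.law x :=
        lintegral_tsum fun k => (hmeas k).aemeasurable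
    _ ≤ ∑' k, ∑' y, Q.tabooProb x k y * (ENNReal.ofReal (Q.exitRate y))⁻¹ :=
        ENNReal.tsum_le_tsum fun k => Q.lintegral_avoid_mul_holdingTime_le x k
    _ = ∑' y, (∑' k, Q.tabooProb x k y) * (ENNReal.ofReal (Q.exitRate y))⁻¹ := by
        rw [ENNReal.tsum_comm]
        simp_rw [ENNReal.tsum_mul_right]
    _ ≤ ∑' y, m {y} * (w x)⁻¹ := by
        refine ENNReal.tsum_le_tsum fun y => ?_
        calc (∑' k, Q.tabooProb x k y) * (ENNReal.ofReal (Q.exitRate y))⁻¹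
            ≤ w y / w x * (ENNReal.ofReal (Q.exitRate y))⁻¹ := by
              gcongr
              exact hvisits y
          _ = m {y} * (w x)⁻¹ * (ENNReal.ofReal (Q.exitRate y) *
                (ENNReal.ofReal (Q.exitRate y))⁻¹) := by
              rw [hwdef, div_eq_mul_inv]
              ring
          _ = m {y} * (w x)⁻¹ := by
              rw [ENNReal.mul_inv_cancel (hq0 y) ENNReal.ofReal_ne_top, mul_one]
    _ = (w x)⁻¹ := by rw [ENNReal.tsum_mul_right, hmass, one_mul]
    _ < ∞ := ENNReal.inv_lt_top.mpr (pos_iff_ne_zero.mpr hwx0)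

end Recurrence
end QMatrix

/-! ### Global balance -/

namespace QMatrix

variable {S : Type*} (Q : QMatrix S)

theorem exitRate_nonneg (x : S) : 0 ≤ Q.exitRate x := by
  classical
  have h := (Q.hasSum_rate x).sub (hasSum_ite_eq x (Q.rate x x))
  rw [zero_sub] at h
  refine h.nonneg fun y => ?_
  split_ifs with hy
  · simp [hy]
  · simpa using Q.rate_nonneg x y (Ne.symm hy)

theorem jumpRate_of_ne {x y : S} (h : x ≠ y) : Q.jumpRate x y = ENNReal.ofReal (Q.rate x y) :=
  if_neg h.symm

theorem Edge.ne {x y : S} (h : Q.Edge x y) : x ≠ y := by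
  rintro rfl
  simp [Edge, jumpRate] at h

theorem edge_iff {x y : S} : Q.Edge x y ↔ x ≠ y ∧ 0 < Q.rate x y := by
  refine ⟨fun h => ⟨Edge.ne Q h, ?_⟩, fun h => ?_⟩
  · rw [Edge, Q.jumpRate_of_ne (Edge.ne Q h)] at h
    exact ENNReal.ofReal_pos.mp h
  · rw [Edge, Q.jumpRate_of_ne h.1]
    exact ENNReal.ofReal_pos.mpr h.2

/-- The equation `c Q = 0`, as a balance of the flows into and out of a state. -/
theorem tsum_mul_jumpRate_eq {c : S → ℝ} (hc : ∀ x, 0 ≤ c x) {y : S}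
    (h : HasSum (fun x => c x * Q.rate x y) 0) :
    ∑' x, ENNReal.ofReal (c x) * Q.jumpRate x y =
      ENNReal.ofReal (c y) * ENNReal.ofReal (Q.exitRate y) := by
  classical
  have h1 := h.sub (hasSum_ite_eq y (c y * Q.rate y y))
  have hf : ∀ x, ENNReal.ofReal (c x) * Q.jumpRate x y =
      ENNReal.ofReal (c x * Q.rate x y - if x = y then c y * Q.rate y y else 0) := by
    intro x
    rcases eq_or_ne x y with rfl | hxy
    · simp [jumpRate]
    · rw [Q.jumpRate_of_ne hxy, if_neg hxy, sub_zero, ENNReal.ofReal_mul (hc x)]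
  rw [tsum_congr hf, ← ENNReal.ofReal_tsum_of_nonneg _ h1.summable, h1.tsum_eq,
    ← ENNReal.ofReal_mul (hc y), exitRate]
  · congr 1
    ring
  · intro x
    split_ifs with hx
    · simp [hx]
    · simpa using mul_nonneg (hc x) (Q.rate_nonneg x y hx)

/-- Positive mass propagates along edges, because the inflow into a state equals its outflow. -/
theorem measure_pos_of_reachable [Countable S] [MeasurableSpace S] {m : Measure S}
    (hm : ∀ y, ∑' x, m {x} * Q.jumpRate x y = m {y} * ENNReal.ofReal (Q.exitRate y)) {x y : S}
    (hxy : Relation.ReflTransGen Q.Edge x y) (hx : 0 < m {x}) : 0 < m {y} := by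
  induction hxy with
  | refl => exact hx
  | @tail z w _ hzw ih =>
    have h1 : 0 < m {z} * Q.jumpRate z w := ENNReal.mul_pos ih.ne' hzw.ne'
    have h2 : 0 < m {w} * ENNReal.ofReal (Q.exitRate w) :=
      hm w ▸ h1.trans_le (ENNReal.le_tsum z)
    exact pos_iff_ne_zero.mpr (left_ne_zero_of_mul h2.ne')

end QMatrix

/-! ### The queue in a random environment -/

section Queue

variable {D : Type*} {lam mu : D → ℝ}

theorem traffic_pos (hlam : ∀ z, 0 < lam z) (hmu : ∀ z, 0 < mu z) (z : D) : 0 < traffic lam mu z :=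
  div_pos (hlam z) (hmu z)

/-- The geometric weights are stationary for the `M/M/1` queue. -/
theorem hasSum_pow_mul_queueRate {a b : ℝ} (hb : b ≠ 0) (n : ℕ) :
    HasSum (fun m => (a / b) ^ m * queueRate a b m n) 0 := by
  have hab : a / b * b = a := div_mul_cancel₀ a hb
  have h : ∑ m ∈ Finset.range (n + 2), (a / b) ^ m * queueRate a b m n = 0 := by
    cases n with
    | zero =>
      simp [queueRate, Finset.sum_range_succ, hab]
    | succ k =>
      rw [Finset.sum_range_succ, Finset.sum_range_succ, Finset.sum_range_succ,
        Finset.sum_eq_zero]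
      · have h1 : queueRate a b k (k + 1) = a := by simp [queueRate]
        have h2 : queueRate a b (k + 1) (k + 1) = -(a + b) := by simp [queueRate]
        have h3 : queueRate a b (k + 1 + 1) (k + 1) = b := by
          unfold queueRate
          rw [if_neg (by omega), if_pos rfl]
        rw [h1, h2, h3, pow_succ, pow_succ]
        linear_combination ((a / b) ^ k * (a / b) - (a / b) ^ k) * hab
      · intro m hm
        have := Finset.mem_range.mp hm
        unfold queueRate
        rw [if_neg (by omega), if_neg (by omega), if_neg (by omega), mul_zero]
  rw [← h]
  refine hasSum_sum_of_ne_finset_zero fun m hm => ?_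
  have : ¬ m < n + 2 := fun hlt => hm (Finset.mem_range.mpr hlt)
  unfold queueRate
  rw [if_neg (by omega), if_neg (by omega), if_neg (by omega), mul_zero]

theorem exitRate_queueEnvGenerator_pos (hlam : ∀ z, 0 < lam z) (hmu : ∀ z, 0 < mu z)
    (T : ℕ → QMatrix D) (x : ℕ × D) : 0 < (queueEnvGenerator lam mu hlam hmu T).exitRate x := by
  obtain ⟨n, z⟩ := x
  have h1 := (T n).exitRate_nonneg z
  have h2 : 0 ≤ (traffic lam mu z ^ n)⁻¹ * (T n).exitRate z :=
    mul_nonneg (inv_nonneg.mpr (pow_pos (traffic_pos hlam hmu z) n).le) h1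
  have h3 : queueRate (lam z) (mu z) n n = -(lam z + if n = 0 then 0 else mu z) := by
    simp [queueRate]
  have h4 : 0 ≤ if n = 0 then 0 else mu z := by
    split_ifs
    exacts [le_rfl, (hmu z).le]
  have h5 := hlam z
  simp only [QMatrix.exitRate, queueEnvGenerator, if_true, h3] at h2 ⊢
  linarith

/-- From any state, the queue moves freely in the first coordinate, and the environment connects
the states of each level. -/
theorem reflTransGen_edge_queueEnvGenerator (hlam : ∀ z, 0 < lam z) (hmu : ∀ z, 0 < mu z)
    {T : ℕ → QMatrix D} (hT : ∀ n z w, Relation.ReflTransGen (T n).Edge z w) (x y : ℕ × D) :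
    Relation.ReflTransGen (queueEnvGenerator lam mu hlam hmu T).Edge x y := by
  set R := queueEnvGenerator lam mu hlam hmu T with hR
  have hup : ∀ n z, R.Edge (n, z) (n + 1, z) := fun n z =>
    R.edge_iff.mpr ⟨by simp, by simp [hR, queueEnvGenerator, queueRate, hlam z]⟩
  have hdown : ∀ n z, R.Edge (n + 1, z) (n, z) := fun n z =>
    R.edge_iff.mpr ⟨by simp, by
      have h : ¬ n = n + 1 + 1 := by omega
      simp [hR, queueEnvGenerator, queueRate, hmu z, h]⟩
  have henv : ∀ n z w, (T n).Edge z w → R.Edge (n, z) (n, w) := by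
    intro n z w h
    obtain ⟨hne, hpos⟩ := (T n).edge_iff.mp h
    refine R.edge_iff.mpr ⟨by simp [hne], ?_⟩
    have h1 := mul_pos (inv_pos.mpr (pow_pos (traffic_pos hlam hmu z) n)) hpos
    simpa [hR, queueEnvGenerator, hne.symm] using h1
  have hto0 : ∀ n z, Relation.ReflTransGen R.Edge (n, z) (0, z) := by
    intro n z
    induction n with
    | zero => exact .refl
    | succ n ih => exact .head (hdown n z) ih
  have hfrom0 : ∀ n z, Relation.ReflTransGen R.Edge (0, z) (n, z) := by
    intro n z
    induction n with
    | zero => exact .refl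
    | succ n ih => exact .tail ih (hup n z)
  exact ((hto0 x.1 x.2).trans ((hT 0 x.2 y.2).lift (fun w => (0, w)) (henv 0))).trans (hfrom0 y.1 y.2)

open scoped Classical in
/-- The unnormalized product form `ρ(z)^n v(z)` solves the global balance equations: the arrivals and
services balance for each fixed `z`, and the factor `ρ(z)^n` cancels against the speed `ρ(z)^{-n}`
of the environment. -/
theorem hasSum_mul_rate_queueEnvGenerator (hlam : ∀ z, 0 < lam z) (hmu : ∀ z, 0 < mu z)
    {T : ℕ → QMatrix D} {v : D → ℝ} (hinv : ∀ n z, HasSum (fun w => v w * (T n).rate w z) 0)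
    (y : ℕ × D) :
    HasSum (fun x : ℕ × D => traffic lam mu x.2 ^ x.1 * v x.2 *
      (queueEnvGenerator lam mu hlam hmu T).rate x y) 0 := by
  obtain ⟨n, z⟩ := y
  have h1 : HasSum (fun x : ℕ × D => traffic lam mu x.2 ^ x.1 * v x.2 *
      if z = x.2 then queueRate (lam x.2) (mu x.2) x.1 n else 0) 0 := by
    have hi : Function.Injective fun m : ℕ => (m, z) := fun a b h => (Prod.mk.inj h).1
    refine (hi.hasSum_iff ?_).mp ?_
    · rintro ⟨m, w⟩ hw
      have : z ≠ w := fun h => hw ⟨m, by rw [h]⟩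
      simp [this]
    · have h := (hasSum_pow_mul_queueRate (a := lam z) (hmu z).ne' n).mul_left (v z)
      rw [mul_zero] at h
      refine Eq.subst (motive := fun f => HasSum f 0) (funext fun m => ?_) h
      simp only [Function.comp_apply, if_true, traffic]
      ring
  have h2 : HasSum (fun x : ℕ × D => traffic lam mu x.2 ^ x.1 * v x.2 *
      if n = x.1 then (traffic lam mu x.2 ^ x.1)⁻¹ * (T x.1).rate x.2 z else 0) 0 := by
    have hi : Function.Injective fun w : D => (n, w) := fun a b h => (Prod.mk.inj h).2
    refine (hi.hasSum_iff ?_).mp ?_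
    · rintro ⟨m, w⟩ hw
      have : n ≠ m := fun h => hw ⟨w, by rw [h]⟩
      simp [this]
    · refine Eq.subst (motive := fun f => HasSum f 0) (funext fun w => ?_) (hinv n z)
      have h := (pow_pos (traffic_pos hlam hmu w) n).ne'
      simp only [Function.comp_apply, if_true]
      field_simp
  have h3 := h1.add h2
  rw [add_zero] at h3
  refine Eq.subst (motive := fun f => HasSum f 0) (funext fun x => ?_) h3
  rw [← mul_add]
  rfl

theorem stationaryMeasure_singleton [Countable D] [MeasurableSpace D] [DiscreteMeasurableSpace D]
    (v : D → ℝ) (x : ℕ × D) : stationaryMeasure lam mu v {x} =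
      ENNReal.ofReal (traffic lam mu x.2 ^ x.1 * v x.2 / normConst lam mu v) := by
  rw [stationaryMeasure, Measure.sum_apply _ (measurableSet_singleton x), tsum_eq_single x]
  · simp
  · intro z hz
    simp [hz]

theorem normConst_pos {v : D → ℝ}
    (hv : ∀ z, 0 ≤ v z) (hv0 : ∃ z, v z ≠ 0) (hrho : ∀ z, traffic lam mu z < 1)
    (hXi : Summable fun z => v z / (1 - traffic lam mu z)) : 0 < normConst lam mu v := by
  obtain ⟨z, hz⟩ := hv0
  exact hXi.tsum_pos (fun w => div_nonneg (hv w) (sub_pos.mpr (hrho w)).le) z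
    (div_pos ((hv z).lt_of_ne' hz) (sub_pos.mpr (hrho z)))

theorem isProbabilityMeasure_stationaryMeasure [Countable D] [MeasurableSpace D]
    [DiscreteMeasurableSpace D] (hlam : ∀ z, 0 < lam z) (hmu : ∀ z, 0 < mu z) {v : D → ℝ}
    (hv : ∀ z, 0 ≤ v z) (hv0 : ∃ z, v z ≠ 0) (hrho : ∀ z, traffic lam mu z < 1)
    (hXi : Summable fun z => v z / (1 - traffic lam mu z)) :
    IsProbabilityMeasure (stationaryMeasure lam mu v) := by
  have hpos := normConst_pos hv hv0 hrho hXi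
  refine ⟨?_⟩
  rw [← Measure.tsum_indicator_apply_singleton _ _ MeasurableSet.univ]
  simp only [Set.indicator_univ, stationaryMeasure_singleton]
  have hgeom : ∀ z, HasSum (fun n : ℕ => traffic lam mu z ^ n * v z / normConst lam mu v)
      (v z / (1 - traffic lam mu z) / normConst lam mu v) := by
    intro z
    have h := (hasSum_geometric_of_lt_one (traffic_pos hlam hmu z).le (hrho z)).mul_right
      (v z / normConst lam mu v)
    have h1 : (fun n => traffic lam mu z ^ n * (v z / normConst lam mu v)) =
        fun n => traffic lam mu z ^ n * v z / normConst lam mu v :=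
      funext fun n => (mul_div_assoc _ _ _).symm
    rwa [h1, ← mul_div_assoc, mul_comm _ (v z), ← div_eq_mul_inv] at h
  have hsum : ∀ z, ∑' n : ℕ, ENNReal.ofReal (traffic lam mu z ^ n * v z / normConst lam mu v) =
      ENNReal.ofReal (v z / (1 - traffic lam mu z) / normConst lam mu v) := by
    intro z
    rw [← ENNReal.ofReal_tsum_of_nonneg _ (hgeom z).summable, (hgeom z).tsum_eq]
    exact fun n => div_nonneg (mul_nonneg (pow_nonneg (traffic_pos hlam hmu z).le n) (hv z)) hpos.le
  rw [ENNReal.tsum_prod', ENNReal.tsum_comm]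
  simp only [hsum]
  rw [← ENNReal.ofReal_tsum_of_nonneg _ (hXi.div_const _), tsum_div_const]
  · have h : (∑' z, v z / (1 - traffic lam mu z)) = normConst lam mu v := rfl
    rw [h, div_self hpos.ne', ENNReal.ofReal_one]
  · exact fun z => div_nonneg (div_nonneg (hv z) (sub_pos.mpr (hrho z)).le) hpos.le

end Queue

theorem mainTheorem3 {D : Type*} [Countable D] [MeasurableSpace D] [DiscreteMeasurableSpace D]
    (lam mu : D → ℝ) (hlam : ∀ z, 0 < lam z) (hmu : ∀ z, 0 < mu z)
    (T : ℕ → QMatrix D) (hT : ∀ n, (T n).IsIrreducible)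
    (hR : (queueEnvGenerator lam mu hlam hmu T).NonExplosive)
    (v : D → ℝ) (hv : ∀ z, 0 ≤ v z) (hv0 : ∃ z, v z ≠ 0)
    (hinv : ∀ n z, HasSum (fun z' => v z' * (T n).rate z' z) (v z * ∑' z', (T n).rate z z'))
    (hrho : ∀ z, traffic lam mu z < 1)
    (hXi : Summable fun z => v z / (1 - traffic lam mu z)) :
    (queueEnvGenerator lam mu hlam hmu T).IsIrreducible ∧
    (queueEnvGenerator lam mu hlam hmu T).IsAperiodic ∧
    (queueEnvGenerator lam mu hlam hmu T).IsPositiveRecurrent ∧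
    IsProbabilityMeasure (stationaryMeasure lam mu v) ∧
    (∀ t : ℝ≥0, ((queueEnvGenerator lam mu hlam hmu T).transition t).Invariant
      (stationaryMeasure lam mu v)) ∧
    ∀ x : ℕ × D, Tendsto
      (fun t : ℝ≥0 => tvDist ((queueEnvGenerator lam mu hlam hmu T).transition t x)
        (stationaryMeasure lam mu v)) atTop (𝓝 0) := by
  set R := queueEnvGenerator lam mu hlam hmu T with hRdef
  set m := stationaryMeasure lam mu v with hmdef
  have hXipos := normConst_pos hv hv0 hrho hXi
  have hprob : IsProbabilityMeasure m :=
    isProbabilityMeasure_stationaryMeasure hlam hmu hv hv0 hrho hXi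
  have hq : ∀ x, 0 < R.exitRate x := exitRate_queueEnvGenerator_pos hlam hmu T
  have hreach : ∀ x y, Relation.ReflTransGen R.Edge x y := by
    refine reflTransGen_edge_queueEnvGenerator hlam hmu fun n z w => ?_
    obtain ⟨t, -, ht⟩ := hT n z w
    exact (T n).reflTransGen_of_transition_pos ht
  have hbalance : ∀ y, ∑' x, m {x} * R.jumpRate x y = m {y} * ENNReal.ofReal (R.exitRate y) := by
    intro y
    simp only [hmdef, stationaryMeasure_singleton]
    refine R.tsum_mul_jumpRate_eq (fun x => div_nonneg (mul_nonneg
      (pow_nonneg (traffic_pos hlam hmu x.2).le x.1) (hv x.2)) hXipos.le) ?_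
    have h := (hasSum_mul_rate_queueEnvGenerator hlam hmu (T := T) (v := v) (fun n z => by
      simpa [((T n).hasSum_rate z).tsum_eq] using hinv n z) y).div_const (normConst lam mu v)
    rw [zero_div] at h
    exact Eq.subst (motive := fun f => HasSum f 0)
      (funext fun x => (div_mul_eq_mul_div _ _ _).symm) h
  have hmpos : ∀ x, 0 < m {x} := by
    obtain ⟨z, hz⟩ := hv0
    intro x
    refine R.measure_pos_of_reachable hbalance (hreach (0, z) x) ?_
    rw [hmdef, stationaryMeasure_singleton]
    exact ENNReal.ofReal_pos.mpr (div_pos (mul_pos (pow_pos (traffic_pos hlam hmu z) 0)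
      ((hv z).lt_of_ne' hz)) hXipos)
  have hMarkov := R.isMarkovKernel_transition hR
  have hinvt := R.invariant_transition hq hR m hbalance
  refine ⟨fun x y => ⟨1, one_pos, R.transition_pos hq (hreach x y) one_pos⟩, ?_,
    R.isPositiveRecurrent_of_balance hq hR m hbalance hmpos, hprob, hinvt, fun x => ?_⟩
  · intro x h _ d hd
    exact Nat.dvd_one.mp (hd 1 (R.transition_self_pos hq x _))
  · exact tendsto_tvDist_of_tendsto_singleton fun y =>
      tendsto_semigroup_singleton (R.transition_add hq) hinvt hmpos
        (fun x y => R.transition_pos hq (hreach x y) one_pos) x y
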